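/- Let $\ell\in\mathbb{N}=\{0,1,2,\dots\}$, $\beta\in[0,1)$ and $\sigma\in(-\infty,\tfrac12)$ be fixed, and let $\zeta^{(\ell)}$ denote the $\ell$-th derivative of the Riemann zeta function. Then, as $T\to\infty$, $$\max_{T^{\beta}\le t\le T}\bigl|\zeta^{(\ell)}(\sigma+it)\bigr| \;\ge\; (1+o(1))\,(2\pi)^{\sigma-\frac12}\sqrt{\frac{\zeta(2-2\sigma)}{2-2\sigma}}\;T^{\frac12-\sigma}(\log T)^{\ell},$$ where $o(1)$ denotes a real function of $T$ (which may depend on $\ell,\beta,\sigma$) tending to $0$ as $T\to\infty$. -/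

import Mathlib

open Filter Topology Set

/-!
The proof tests `ζ^(ℓ)` on the line `re s = σ` against the Mellin transform of the resonator
`f(y) = ∑_{m ≤ N} m ^ (2σ - 1) b(m y) exp(-i T m y)`, where `b` is a smooth cutoff of `[w, 1]` with
`w < 1` close to `1`. By non-stationary phase the transform is negligible outside the window
`w T ≤ im s ≤ T`, so Mellin inversion, a contour shift, the Cauchy–Schwarz inequality on the window
and Plancherel's theorem bound `∑ (log n)^ℓ f(n / X)` by the maximum `M` of `|ζ^(ℓ)(σ + i t)|` over
the window times an explicit `L²` norm. The latter is a sum over `m ≤ N` because the dilates of `b`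
have disjoint supports once `N ≤ w (N + 1)`.

With `T = 2 π X` every phase `exp(-i T m n / X)` equals `1`, so the same sum consists of nonnegative
terms and is `~ (1 - w) ∑_{m ≤ N} m ^ (2σ - 2) · X (log X)^ℓ`. The weights `m ^ (2σ - 1)` make the
quotient of the two estimates largest, and letting `N → ∞` and `w → 1` yields
`M ≥ (1 - o(1)) √ζ(2 - 2σ) X ^ (1/2 - σ) (log X)^ℓ`.
-/

section PolynomialGrowth

/-- Holomorphic functions on the half-plane `a < re s` that are polynomially bounded on every
smaller closed half-plane. -/
structure HasPolynomialGrowth (a : ℝ) (f : ℂ → ℂ) : Prop where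
  differentiableOn : DifferentiableOn ℂ f {s | a < s.re}
  exists_norm_le : ∀ A > a, ∃ C : ℝ, 0 ≤ C ∧ ∃ k : ℕ, ∀ s : ℂ, A ≤ s.re →
    ‖f s‖ ≤ C * (1 + ‖s‖) ^ k

namespace HasPolynomialGrowth

variable {a b : ℝ} {f g : ℂ → ℂ}

lemma mono (hf : HasPolynomialGrowth a f) (hab : a ≤ b) : HasPolynomialGrowth b f where
  differentiableOn := hf.differentiableOn.mono fun _ hs => hab.trans_lt hs
  exists_norm_le A hA := hf.exists_norm_le A (hab.trans_lt hA)

lemma congr (hf : HasPolynomialGrowth a f) (h : EqOn g f {s | a < s.re}) :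
    HasPolynomialGrowth a g where
  differentiableOn := hf.differentiableOn.congr h
  exists_norm_le A hA := by
    obtain ⟨C, hC, k, hk⟩ := hf.exists_norm_le A hA
    exact ⟨C, hC, k, fun s hs => by simpa only [h (hA.trans_le hs)] using hk s hs⟩

protected lemma const (a : ℝ) (c : ℂ) : HasPolynomialGrowth a fun _ => c where
  differentiableOn := differentiableOn_const c
  exists_norm_le _ _ := ⟨‖c‖, norm_nonneg c, 0, fun _ _ => by simp⟩

protected lemma id (a : ℝ) : HasPolynomialGrowth a fun s => s where
  differentiableOn := differentiableOn_id
  exists_norm_le _ _ := ⟨1, zero_le_one, 1, fun s _ => by simp⟩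

protected lemma add (hf : HasPolynomialGrowth a f) (hg : HasPolynomialGrowth a g) :
    HasPolynomialGrowth a fun s => f s + g s where
  differentiableOn := hf.differentiableOn.add hg.differentiableOn
  exists_norm_le A hA := by
    obtain ⟨C, hC, k, hk⟩ := hf.exists_norm_le A hA
    obtain ⟨D, hD, l, hl⟩ := hg.exists_norm_le A hA
    refine ⟨C + D, add_nonneg hC hD, k + l, fun s hs => ?_⟩
    have one_le : 1 ≤ 1 + ‖s‖ := le_add_of_nonneg_right (norm_nonneg s)
    calc ‖f s + g s‖ ≤ C * (1 + ‖s‖) ^ k + D * (1 + ‖s‖) ^ l :=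
          norm_add_le_of_le (hk s hs) (hl s hs)
      _ ≤ C * (1 + ‖s‖) ^ (k + l) + D * (1 + ‖s‖) ^ (k + l) := by
          gcongr <;> first | exact one_le | omega
      _ = _ := by ring

protected lemma mul (hf : HasPolynomialGrowth a f) (hg : HasPolynomialGrowth a g) :
    HasPolynomialGrowth a fun s => f s * g s where
  differentiableOn := hf.differentiableOn.mul hg.differentiableOn
  exists_norm_le A hA := by
    obtain ⟨C, hC, k, hk⟩ := hf.exists_norm_le A hA
    obtain ⟨D, hD, l, hl⟩ := hg.exists_norm_le A hA
    refine ⟨C * D, mul_nonneg hC hD, k + l, fun s hs => ?_⟩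
    calc ‖f s * g s‖ ≤ (C * (1 + ‖s‖) ^ k) * (D * (1 + ‖s‖) ^ l) :=
          norm_mul_le_of_le (hk s hs) (hl s hs)
      _ = _ := by ring

lemma comp_add_one (hf : HasPolynomialGrowth (a + 1) f) :
    HasPolynomialGrowth a fun s => f (s + 1) where
  differentiableOn := hf.differentiableOn.comp (by fun_prop) fun s hs => by
    simpa using hs
  exists_norm_le A hA := by
    obtain ⟨C, hC, k, hk⟩ := hf.exists_norm_le (A + 1) (by linarith)
    refine ⟨C * 2 ^ k, by positivity, k, fun s hs => ?_⟩
    have shift_le : 1 + ‖s + 1‖ ≤ 2 * (1 + ‖s‖) := by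
      linarith [norm_add_le s 1, norm_one (α := ℂ), norm_nonneg s]
    calc ‖f (s + 1)‖ ≤ C * (1 + ‖s + 1‖) ^ k := hk _ (by simpa using hs)
      _ ≤ C * (2 * (1 + ‖s‖)) ^ k := by gcongr
      _ = _ := by rw [mul_pow, mul_assoc]

protected lemma deriv (hf : HasPolynomialGrowth a f) : HasPolynomialGrowth a (deriv f) where
  differentiableOn :=
    hf.differentiableOn.deriv (isOpen_lt continuous_const Complex.continuous_re)
  exists_norm_le A hA := by
    obtain ⟨r, hr, hrA⟩ : ∃ r > 0, a < A - r := ⟨(A - a) / 2, by linarith, by linarith⟩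
    obtain ⟨C, hC, k, hk⟩ := hf.exists_norm_le (A - r) hrA
    refine ⟨C * (1 + r) ^ k / r, by positivity, k, fun s hs => ?_⟩
    have re_le : ∀ z ∈ Metric.closedBall s r, A - r ≤ z.re := fun z hz => by
      have := (abs_le.1 ((Complex.abs_re_le_norm (z - s)).trans (mem_closedBall_iff_norm.1 hz))).1
      rw [Complex.sub_re] at this
      linarith
    have norm_le : ∀ z ∈ Metric.closedBall s r, 1 + ‖z‖ ≤ (1 + r) * (1 + ‖s‖) := fun z hz => by
      nlinarith [norm_le_norm_add_const_of_dist_le (Metric.mem_closedBall.1 hz), norm_nonneg s]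
    have cauchy : ‖deriv f s‖ ≤ C * ((1 + r) * (1 + ‖s‖)) ^ k / r := by
      refine Complex.norm_deriv_le_of_forall_mem_sphere_norm_le hr ?_ fun z hz => ?_
      · refine DifferentiableOn.diffContOnCl (hf.differentiableOn.mono fun z hz => ?_)
        exact hrA.trans_le (re_le z (closure_minimal Metric.ball_subset_closedBall
          Metric.isClosed_closedBall hz))
      · have hz' := Metric.sphere_subset_closedBall hz
        refine (hk z (re_le z hz')).trans ?_
        gcongr
        exact norm_le z hz'
    exact cauchy.trans_eq (by rw [mul_pow]; ring)

lemma iteratedDeriv (hf : HasPolynomialGrowth a f) (n : ℕ) :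
    HasPolynomialGrowth a (iteratedDeriv n f) := by
  induction n with
  | zero => simpa only [iteratedDeriv_zero] using hf
  | succ n ih => simpa only [iteratedDeriv_succ] using ih.deriv

end HasPolynomialGrowth

end PolynomialGrowth

section PeriodicMellin

open MeasureTheory Complex

/-- The Mellin-type transform `∫₁^∞ q({x}) x⁻ˢ dx` of the periodic function `x ↦ q {x}`. -/
noncomputable def periodicMellin (q : ℝ → ℂ) (s : ℂ) : ℂ :=
  ∫ x in Ioi (1 : ℝ), q (Int.fract x) * (x : ℂ) ^ (-s)

variable {q Q : ℝ → ℂ}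

lemma exists_norm_comp_fract_le (hq : Continuous q) :
    ∃ B, 0 ≤ B ∧ ∀ x, ‖q (Int.fract x)‖ ≤ B := by
  obtain ⟨B, hB⟩ := isCompact_Icc.exists_bound_of_continuousOn (hq.continuousOn (s := Icc 0 1))
  refine ⟨B, (norm_nonneg _).trans (hB 0 (by simp)), fun x => hB _ ?_⟩
  exact ⟨Int.fract_nonneg x, (Int.fract_lt_one x).le⟩

lemma aestronglyMeasurable_comp_fract (hq : Continuous q) (μ : Measure ℝ) :
    AEStronglyMeasurable (fun x => q (Int.fract x)) μ :=
  (hq.measurable.comp measurable_fract).aestronglyMeasurable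

lemma integrableOn_comp_fract_mul_cpow (hq : Continuous q) {s : ℂ} (hs : 1 < s.re) :
    IntegrableOn (fun x : ℝ => q (Int.fract x) * (x : ℂ) ^ (-s)) (Ioi 1) := by
  obtain ⟨B, -, hB⟩ := exists_norm_comp_fract_le hq
  refine Integrable.bdd_mul (integrableOn_Ioi_cpow_of_lt ?_ one_pos)
    (aestronglyMeasurable_comp_fract hq _) (ae_of_all _ hB)
  simpa using hs

lemma periodicMellin_eq_mellin (q : ℝ → ℂ) (s : ℂ) :
    periodicMellin q s = mellin (indicator (Ioi 1) fun x => q (Int.fract x)) (1 - s) := by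
  have hindicator : (fun x : ℝ => (x : ℂ) ^ (1 - s - 1) •
      indicator (Ioi 1) (fun x => q (Int.fract x)) x) =
      indicator (Ioi 1) fun x : ℝ => q (Int.fract x) * (x : ℂ) ^ (-s) := by
    ext x
    simp [indicator, mul_comm]
  rw [mellin, hindicator, setIntegral_indicator measurableSet_Ioi, Ioi_inter_Ioi,
    sup_eq_right.2 zero_le_one, periodicMellin]

lemma differentiableAt_periodicMellin (hq : Continuous q) {s : ℂ} (hs : 1 < s.re) :
    DifferentiableAt ℂ (periodicMellin q) s := by
  obtain ⟨B, -, hB⟩ := exists_norm_comp_fract_le hq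
  have hbound : ∀ x, ‖indicator (Ioi (1 : ℝ)) (fun x => q (Int.fract x)) x‖ ≤ B := fun x =>
    (norm_indicator_le_norm_self _ x).trans (hB x)
  have hmeas : AEStronglyMeasurable (indicator (Ioi (1 : ℝ)) fun x => q (Int.fract x)) :=
    (aestronglyMeasurable_comp_fract hq _).indicator measurableSet_Ioi
  have hmellin : DifferentiableAt ℂ
      (mellin (indicator (Ioi 1) fun x => q (Int.fract x))) (1 - s) := by
    refine mellin_differentiableAt_of_isBigO_rpow (a := 0) (b := (1 - s).re - 1)
      ?_ ?_ (by simpa using hs) ?_ (by linarith)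
    · refine LocallyIntegrable.locallyIntegrableOn ?_ _
      exact (locallyIntegrable_const B).mono hmeas
        (ae_of_all _ fun x => (hbound x).trans (Real.le_norm_self B))
    · exact .of_bound B (.of_forall fun x => by simpa using hbound x)
    · refine .of_norm_eventuallyLE ?_
      filter_upwards [mem_nhdsWithin_of_mem_nhds (Iio_mem_nhds one_pos), self_mem_nhdsWithin]
        with x hx1 hx0
      rw [indicator_of_notMem (notMem_Ioi.2 (le_of_lt hx1)), norm_zero]
      exact Real.rpow_nonneg (le_of_lt hx0) _
  rw [funext (periodicMellin_eq_mellin q)]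
  exact hmellin.comp s (by fun_prop)

lemma hasPolynomialGrowth_periodicMellin (hq : Continuous q) :
    HasPolynomialGrowth 1 (periodicMellin q) where
  differentiableOn s hs := (differentiableAt_periodicMellin hq hs).differentiableWithinAt
  exists_norm_le A hA := by
    obtain ⟨B, hB0, hB⟩ := exists_norm_comp_fract_le hq
    refine ⟨∫ x in Ioi (1 : ℝ), B * x ^ (-A), ?_, 0, fun s hs => ?_⟩
    · refine setIntegral_nonneg measurableSet_Ioi fun x hx => ?_
      exact mul_nonneg hB0 (Real.rpow_nonneg (zero_le_one.trans (le_of_lt hx)) _)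
    rw [pow_zero, mul_one]
    refine norm_integral_le_of_norm_le
      ((integrableOn_Ioi_rpow_of_lt (neg_lt_neg hA) one_pos).const_mul B)
      (ae_restrict_of_forall_mem measurableSet_Ioi fun x hx => ?_)
    rw [norm_mul, norm_cpow_eq_rpow_re_of_pos (zero_lt_one.trans hx)]
    refine mul_le_mul (hB x) ?_ (Real.rpow_nonneg (zero_le_one.trans (le_of_lt hx)) _) hB0
    exact Real.rpow_le_rpow_of_exponent_le (le_of_lt hx) (by simpa using hs)

lemma hasDerivWithinAt_fract (x : ℝ) : HasDerivWithinAt (Int.fract : ℝ → ℝ) 1 (Ioi x) x := by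
  have hfloor : ∀ᶠ y : ℝ in 𝓝[>] x, Int.fract y = y - ⌊x⌋ := by
    filter_upwards [Ioo_mem_nhdsGT (Int.lt_floor_add_one x)] with y hy
    rw [Int.fract, Int.floor_eq_iff.2 ⟨(Int.floor_le x).trans hy.1.le, hy.2⟩]
  exact ((hasDerivWithinAt_id x _).sub_const _).congr_of_eventuallyEq hfloor rfl

lemma hasDerivWithinAt_comp_fract_mul_cpow (hQ : ∀ u, HasDerivAt Q (q u) u) (s : ℂ) {x : ℝ}
    (hx : 0 < x) :
    HasDerivWithinAt (fun y : ℝ => Q (Int.fract y) * (y : ℂ) ^ (-s))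
      (q (Int.fract x) * (x : ℂ) ^ (-s) - s * (Q (Int.fract x) * (x : ℂ) ^ (-(s + 1))))
      (Ioi x) x := by
  have hpow := (HasDerivAt.cpow_const (c := -s) (hasDerivAt_id (x : ℂ))
    (Or.inl (by simpa using hx))).comp_ofReal
  refine (((hQ _).scomp_hasDerivWithinAt x (hasDerivWithinAt_fract x)).mul
    hpow.hasDerivWithinAt).congr_deriv ?_
  simp only [id, one_smul, mul_one, neg_add', Function.comp]
  ring

lemma periodicMellin_eq_add_mul (hq : Continuous q) (hQ : ∀ u, HasDerivAt Q (q u) u)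
    (hQ01 : Q 0 = Q 1) {s : ℂ} (hs : 1 < s.re) :
    periodicMellin q s = -Q 0 + s * periodicMellin Q (s + 1) := by
  have hQc : Continuous Q := continuous_iff_continuousAt.2 fun u => (hQ u).continuousAt
  have hre : 1 < (s + 1).re := by simp only [add_re, one_re]; linarith
  have hint : IntegrableOn (fun x : ℝ => q (Int.fract x) * (x : ℂ) ^ (-s) -
      s * (Q (Int.fract x) * (x : ℂ) ^ (-(s + 1)))) (Ioi 1) :=
    (integrableOn_comp_fract_mul_cpow hq hs).sub
      ((integrableOn_comp_fract_mul_cpow hQc hre).const_mul s)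
  have hFTC : ∀ N : ℕ, 1 ≤ N → ∫ x in (1 : ℝ)..N, (q (Int.fract x) * (x : ℂ) ^ (-s) -
      s * (Q (Int.fract x) * (x : ℂ) ^ (-(s + 1)))) = Q 0 * (N : ℂ) ^ (-s) - Q 0 := fun N hN => by
    have hN' : (1 : ℝ) ≤ N := mod_cast hN
    rw [intervalIntegral.integral_eq_sub_of_hasDeriv_right_of_le hN' _
      (fun x hx => hasDerivWithinAt_comp_fract_mul_cpow hQ s (zero_lt_one.trans hx.1))]
    · simp
    · exact (intervalIntegrable_iff_integrableOn_Ioc_of_le hN').2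
        (hint.mono_set Ioc_subset_Ioi_self)
    · refine (hQc.continuousOn.comp_fract'' hQ01).continuousOn.mul ?_
      exact ContinuousOn.cpow_const (by fun_prop) fun x hx =>
        Or.inl (by simpa using zero_lt_one.trans_le hx.1)
  have hboundary : Tendsto (fun N : ℕ => Q 0 * (N : ℂ) ^ (-s) - Q 0) atTop (𝓝 (-Q 0)) := by
    have hdecay : Tendsto (fun N : ℕ => (N : ℂ) ^ (-s)) atTop (𝓝 0) := by
      refine tendsto_zero_iff_norm_tendsto_zero.2 (((tendsto_rpow_neg_atTop
        (zero_lt_one.trans hs)).comp tendsto_natCast_atTop_atTop).congr' ?_)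
      filter_upwards [eventually_gt_atTop 0] with N hN
      simp [norm_natCast_cpow_of_pos hN]
    simpa using (hdecay.const_mul (Q 0)).sub_const (Q 0)
  have hlim := intervalIntegral_tendsto_integral_Ioi 1 hint tendsto_natCast_atTop_atTop
  have heq := tendsto_nhds_unique
    (hlim.congr' ((eventually_ge_atTop 1).mono fun N hN => hFTC N hN)) hboundary
  rw [integral_sub (integrableOn_comp_fract_mul_cpow hq hs)
    ((integrableOn_comp_fract_mul_cpow hQc hre).const_mul s), integral_const_mul] at heq
  exact sub_eq_iff_eq_add.1 heq

lemma exists_hasDerivAt_integral_eq_zero (hq : Continuous q) (hq0 : ∫ u in (0 : ℝ)..1, q u = 0) :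
    ∃ Q : ℝ → ℂ, (∀ u, HasDerivAt Q (q u) u) ∧ Q 0 = Q 1 ∧ ∫ u in (0 : ℝ)..1, Q u = 0 := by
  have hP : ∀ u, HasDerivAt (fun x => ∫ v in (0 : ℝ)..x, q v) (q u) u := fun u =>
    (hq.integral_hasStrictDerivAt 0 u).hasDerivAt
  have hPc : Continuous fun x => ∫ v in (0 : ℝ)..x, q v :=
    continuous_iff_continuousAt.2 fun u => (hP u).continuousAt
  refine ⟨fun x => (∫ v in (0 : ℝ)..x, q v) - ∫ y in (0 : ℝ)..1, ∫ v in (0 : ℝ)..y, q v,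
    fun u => (hP u).sub_const _, by simp [hq0], ?_⟩
  rw [intervalIntegral.integral_sub (hPc.intervalIntegrable _ _) (by simp)]
  simp

lemma exists_hasPolynomialGrowth_eqOn_periodicMellin (R : ℕ) (hq : Continuous q)
    (hq0 : ∫ u in (0 : ℝ)..1, q u = 0) :
    ∃ G, HasPolynomialGrowth (1 - R) G ∧ EqOn G (periodicMellin q) {s | 1 < s.re} := by
  induction R generalizing q with
  | zero =>
    exact ⟨_, by simpa using hasPolynomialGrowth_periodicMellin hq, eqOn_refl _ _⟩
  | succ R ih =>
    obtain ⟨Q, hQ, hQ01, hQ0⟩ := exists_hasDerivAt_integral_eq_zero hq hq0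
    have hQc : Continuous Q := continuous_iff_continuousAt.2 fun u => (hQ u).continuousAt
    obtain ⟨G, hG, hGQ⟩ := ih hQc hQ0
    refine ⟨fun s => -Q 0 + s * G (s + 1), ?_, fun s hs => ?_⟩
    · refine (HasPolynomialGrowth.const _ _).add ((HasPolynomialGrowth.id _).mul ?_)
      exact (hG.mono (by push_cast; linarith)).comp_add_one
    · rw [periodicMellin_eq_add_mul hq hQ hQ01 hs, ← hGQ]
      simp only [mem_ofPred_eq, add_re, one_re] at hs ⊢
      linarith

end PeriodicMellin

section ZetaGrowth

open MeasureTheory Complex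

lemma riemannZeta_eq_mul_integral_floor {s : ℂ} (hs : 1 < s.re) :
    riemannZeta s = s * ∫ t in Ioi (1 : ℝ), (⌊t⌋₊ : ℂ) * (t : ℂ) ^ (-(s + 1)) := by
  rw [← LSeries_one_eq_riemannZeta hs, LSeries_eq_mul_integral' 1 zero_le_one hs]
  · simp
  · simpa using Asymptotics.isBigO_refl (fun n : ℕ => (n : ℝ)) atTop

lemma natFloor_mul_cpow_eq {t : ℝ} (ht : 0 < t) (s : ℂ) :
    (⌊t⌋₊ : ℂ) * (t : ℂ) ^ (-(s + 1)) = (t : ℂ) ^ (-s) - 1 / 2 * (t : ℂ) ^ (-(s + 1)) -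
      ((Int.fract t : ℝ) - 1 / 2) * (t : ℂ) ^ (-(s + 1)) := by
  have hfloor : (⌊t⌋₊ : ℂ) = t - (Int.fract t : ℝ) := by
    rw [← ofReal_natCast, natCast_floor_eq_intCast_floor ht.le, ← Int.self_sub_fract, ofReal_sub]
  have hcpow : (t : ℂ) * (t : ℂ) ^ (-(s + 1)) = (t : ℂ) ^ (-s) := by
    have ht' := ofReal_ne_zero.2 ht.ne'
    rw [neg_add, cpow_add _ _ ht', cpow_neg_one, mul_left_comm, mul_inv_cancel₀ ht', mul_one]
  rw [hfloor, ← hcpow]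
  ring

lemma riemannZeta₀_eq_sub_mul_periodicMellin {s : ℂ} (hs : 1 < s.re) :
    riemannZeta₀ s = 1 / 2 - s * periodicMellin (fun u => u - 1 / 2) (s + 1) := by
  have hs1 : s - 1 ≠ 0 := fun h => by simp [sub_eq_zero.1 h] at hs
  have hs0 : s ≠ 0 := fun h => by norm_num [h] at hs
  have hre : 1 < (s + 1).re := by simp only [add_re, one_re]; linarith
  have hfract : IntegrableOn (fun t : ℝ => ((Int.fract t : ℝ) - 1 / 2 : ℂ) *
      (t : ℂ) ^ (-(s + 1))) (Ioi 1) :=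
    integrableOn_comp_fract_mul_cpow (q := fun u => u - 1 / 2) (by fun_prop) hre
  have hpow : IntegrableOn (fun t : ℝ => (t : ℂ) ^ (-s)) (Ioi 1) :=
    integrableOn_Ioi_cpow_of_lt (by simpa using hs) one_pos
  have hpow' : IntegrableOn (fun t : ℝ => 1 / 2 * (t : ℂ) ^ (-(s + 1))) (Ioi 1) :=
    (integrableOn_Ioi_cpow_of_lt (by simpa using hre) one_pos).const_mul _
  have hfloor : ∫ t in Ioi (1 : ℝ), (⌊t⌋₊ : ℂ) * (t : ℂ) ^ (-(s + 1)) =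
      (s - 1)⁻¹ - 1 / 2 * s⁻¹ - periodicMellin (fun u => u - 1 / 2) (s + 1) := by
    rw [setIntegral_congr_fun measurableSet_Ioi fun t ht =>
        natFloor_mul_cpow_eq (zero_lt_one.trans ht) s,
      integral_sub (by exact hpow.sub hpow') hfract,
      integral_sub hpow hpow', integral_const_mul,
      integral_Ioi_cpow_of_lt (by simpa using hs) one_pos,
      integral_Ioi_cpow_of_lt (by simpa using hre) one_pos, periodicMellin,
      ofReal_one, one_cpow, one_cpow, show -s + 1 = -(s - 1) by ring,
      show -(s + 1) + 1 = -s by ring, neg_div_neg_eq, neg_div_neg_eq, one_div (s - 1), one_div s]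
  have hzeta := riemannZeta_eq_mul_integral_floor hs
  rw [hfloor, riemannZeta_eq_inv_sub_add (sub_ne_zero.1 hs1)] at hzeta
  rw [eq_sub_of_add_eq' hzeta]
  field_simp
  ring

lemma hasPolynomialGrowth_riemannZeta₀ (a : ℝ) : HasPolynomialGrowth a riemannZeta₀ := by
  obtain ⟨R, hR⟩ := exists_nat_gt (-a)
  have hmean : ∫ u in (0 : ℝ)..1, ((u : ℂ) - 1 / 2) = 0 := by
    rw [intervalIntegral.integral_sub (Continuous.intervalIntegrable (by fun_prop) _ _) (by simp),
      intervalIntegral.integral_ofReal]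
    norm_num
  obtain ⟨G, hG, hGE⟩ := exists_hasPolynomialGrowth_eqOn_periodicMellin (R + 1)
    (q := fun u => u - 1 / 2) (by fun_prop) hmean
  have hcont : HasPolynomialGrowth (-R - 1) fun s => 1 / 2 + -1 * s * G (s + 1) := by
    refine (HasPolynomialGrowth.const _ _).add
      (((HasPolynomialGrowth.const _ _).mul (HasPolynomialGrowth.id _)).mul ?_)
    exact (hG.mono (by push_cast; linarith)).comp_add_one
  have hopen : IsOpen {s : ℂ | (-R - 1 : ℝ) < s.re} := isOpen_lt continuous_const continuous_re
  have heq : EqOn riemannZeta₀ (fun s => 1 / 2 + -1 * s * G (s + 1)) {s | (-R - 1 : ℝ) < s.re} := by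
    refine AnalyticOnNhd.eqOn_of_preconnected_of_eventuallyEq
      (differentiable_riemannZeta₀.differentiableOn.analyticOnNhd hopen)
      (hcont.differentiableOn.analyticOnNhd hopen) (convex_halfSpace_re_gt _).isPreconnected
      (z₀ := 2) ?_ ?_
    · simp only [mem_ofPred_eq, re_ofNat]
      linarith [R.cast_nonneg (α := ℝ)]
    · filter_upwards [(isOpen_lt continuous_const continuous_re).mem_nhds
        (show (1 : ℝ) < (2 : ℂ).re by norm_num)] with s (hs : 1 < s.re)
      rw [riemannZeta₀_eq_sub_mul_periodicMellin hs, hGE]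
      · ring
      · simp only [mem_ofPred_eq, add_re, one_re]
        linarith
  exact (hcont.congr heq).mono (by linarith)

/-- The principal part at `s = 1` of the `ℓ`-th derivative of the Riemann zeta function. -/
noncomputable def zetaPrincipalPart (ℓ : ℕ) (s : ℂ) : ℂ :=
  (-1) ^ ℓ * ℓ.factorial / (s - 1) ^ (ℓ + 1)

lemma iteratedDeriv_riemannZeta_eq (ℓ : ℕ) {s : ℂ} (hs : s ≠ 1) :
    iteratedDeriv ℓ riemannZeta s =
      zetaPrincipalPart ℓ s + iteratedDeriv ℓ riemannZeta₀ s := by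
  have hpole : riemannZeta =ᶠ[𝓝 s] (fun z => (z - 1)⁻¹) + riemannZeta₀ := by
    filter_upwards [compl_singleton_mem_nhds hs] with z hz
    exact riemannZeta_eq_inv_sub_add hz
  have hsmooth : ContDiffAt ℂ ℓ (fun z : ℂ => (z - 1)⁻¹) s :=
    (contDiffAt_id.sub contDiffAt_const).inv (sub_ne_zero.2 hs)
  have hinv : iteratedDeriv ℓ (fun z : ℂ => (z - 1)⁻¹) s = zetaPrincipalPart ℓ s := by
    rw [iteratedDeriv_comp_sub_const ℓ (fun z : ℂ => z⁻¹) 1, iteratedDeriv_eq_iterate]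
    refine (iter_deriv_inv ℓ (s - 1)).trans ?_
    rw [zetaPrincipalPart, div_eq_mul_inv,
      show (-1 - (ℓ : ℤ)) = -((ℓ + 1 : ℕ) : ℤ) by push_cast; ring, zpow_neg, zpow_natCast]
  rw [hpole.iteratedDeriv_eq ℓ, iteratedDeriv_add hsmooth
    differentiable_riemannZeta₀.contDiff.contDiffAt, hinv]

end ZetaGrowth

section Mellin

open MeasureTheory Complex

open scoped FourierTransform

variable {σ x : ℝ} {g : ℂ → ℂ} {f : ℝ → ℂ}

lemma norm_cpow_neg_vertical (hx : 0 < x) (σ t : ℝ) :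
    ‖(x : ℂ) ^ (-((σ : ℂ) + t * I))‖ = x ^ (-σ) := by
  simp [norm_cpow_eq_rpow_re_of_pos hx]

lemma verticalIntegrable_cpow_neg_mul (hx : 0 < x) (hg : VerticalIntegrable g σ) :
    VerticalIntegrable (fun s => (x : ℂ) ^ (-s) * g s) σ := by
  refine Integrable.bdd_mul hg (Continuous.aestronglyMeasurable ?_)
    (ae_of_all _ fun t => (norm_cpow_neg_vertical hx σ t).le)
  exact Continuous.const_cpow (by fun_prop) (Or.inl (ofReal_ne_zero.2 hx.ne'))

lemma mellinInv_add {h : ℂ → ℂ} (hx : 0 < x) (hg : VerticalIntegrable g σ)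
    (hh : VerticalIntegrable h σ) :
    mellinInv σ (fun s => g s + h s) x = mellinInv σ g x + mellinInv σ h x := by
  simp only [mellinInv, smul_eq_mul, mul_add, ← smul_add]
  rw [integral_add (verticalIntegrable_cpow_neg_mul hx hg) (verticalIntegrable_cpow_neg_mul hx hh)]

lemma norm_mellinInv_le (hx : 0 < x) (σ : ℝ) (g : ℂ → ℂ) :
    ‖mellinInv σ g x‖ ≤ x ^ (-σ) / (2 * Real.pi) * ∫ t : ℝ, ‖g (σ + t * I)‖ := by
  have hnorm : ‖∫ t : ℝ, (x : ℂ) ^ (-((σ : ℂ) + t * I)) • g (σ + t * I)‖ ≤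
      x ^ (-σ) * ∫ t : ℝ, ‖g (σ + t * I)‖ := by
    refine (norm_integral_le_integral_norm _).trans_eq ?_
    simp only [norm_smul, norm_cpow_neg_vertical hx, integral_const_mul]
  rw [mellinInv, norm_smul, Real.norm_of_nonneg (by positivity), div_mul_eq_mul_div,
    div_mul_eq_mul_div, one_mul]
  gcongr

lemma verticalIntegrable_of_decay {σ C : ℝ} (hg : Continuous fun t : ℝ => g (σ + t * I))
    (hC : ∀ t : ℝ, ‖g (σ + t * I)‖ * (1 + |t|) ^ 2 ≤ C) : VerticalIntegrable g σ := by
  refine (integrable_inv_one_add_sq.const_mul C).mono' hg.aestronglyMeasurable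
    (ae_of_all _ fun t => ?_)
  rw [← div_eq_mul_inv, le_div_iff₀ (by positivity)]
  refine le_trans ?_ (hC t)
  gcongr
  nlinarith [abs_nonneg t, sq_abs t]

lemma tendsto_integral_horizontal_of_decay {a b C : ℝ} (hab : a ≤ b)
    (hC : ∀ s : ℂ, s.re ∈ Icc a b → ‖g s‖ * (1 + |s.im|) ^ 2 ≤ C) {l : Filter ℝ} {y : ℝ → ℝ}
    (hy : Tendsto (fun R => |y R|) l atTop) :
    Tendsto (fun R : ℝ => ∫ u in a..b, g (u + y R * I)) l (𝓝 0) := by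
  have hbound : ∀ R, ‖∫ u in a..b, g (u + y R * I)‖ ≤ C / (1 + |y R|) ^ 2 * |b - a| := fun R => by
    refine intervalIntegral.norm_integral_le_of_norm_le_const fun u hu => ?_
    rw [uIoc_of_le hab] at hu
    rw [le_div_iff₀ (by positivity)]
    simpa using hC (u + y R * I) (by simpa using Ioc_subset_Icc_self hu)
  refine squeeze_zero_norm hbound ?_
  have hpow : Tendsto (fun R => (1 + |y R|) ^ 2) l atTop :=
    (tendsto_pow_atTop two_ne_zero).comp (tendsto_atTop_add_const_left _ 1 hy)
  simpa using (hpow.const_div_atTop C).mul_const |b - a|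

lemma integral_vertical_eq_of_decay {a b C : ℝ} (hab : a ≤ b)
    (hg : DifferentiableOn ℂ g (re ⁻¹' Icc a b))
    (hC : ∀ s : ℂ, s.re ∈ Icc a b → ‖g s‖ * (1 + |s.im|) ^ 2 ≤ C) :
    ∫ t : ℝ, g (a + t * I) = ∫ t : ℝ, g (b + t * I) := by
  have hlim : ∀ c ∈ Icc a b, Tendsto (fun R : ℝ => ∫ t in (-R)..R, g (c + t * I)) atTop
      (𝓝 (∫ t : ℝ, g (c + t * I))) := fun c hc => by
    refine intervalIntegral_tendsto_integral ?_ tendsto_neg_atTop_atBot tendsto_id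
    refine verticalIntegrable_of_decay (hg.continuousOn.comp_continuous (by fun_prop) fun t => ?_)
      (C := C) fun t => ?_
    · simpa using hc
    · simpa using hC (c + t * I) (by simpa using hc)
  have hrect : ∀ R : ℝ, I * (∫ t in (-R)..R, g (b + t * I)) -
      I * (∫ t in (-R)..R, g (a + t * I)) =
      (∫ u in a..b, g (u + R * I)) - ∫ u in a..b, g (u + (-R : ℝ) * I) := fun R => by
    have := integral_boundary_rect_eq_zero_of_differentiableOn g ⟨a, -R⟩ ⟨b, R⟩
      (hg.mono fun s hs => by simpa only [uIcc_of_le hab] using hs.1)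
    simp only [smul_eq_mul] at this
    linear_combination this
  have hhoriz := (tendsto_integral_horizontal_of_decay hab hC tendsto_abs_atTop_atTop).sub
    (tendsto_integral_horizontal_of_decay hab hC (y := fun R => -R)
      (by simpa only [abs_neg] using tendsto_abs_atTop_atTop))
  have hvert := ((hlim b ⟨hab, le_rfl⟩).const_mul I).sub ((hlim a ⟨le_rfl, hab⟩).const_mul I)
  have heq := tendsto_nhds_unique (hvert.congr hrect) hhoriz
  rw [sub_zero, ← mul_sub, mul_eq_zero, or_iff_right I_ne_zero, sub_eq_zero] at heq
  exact heq.symm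

lemma mellinInv_eq_of_decay {a b C : ℝ} (hab : a ≤ b) (hx : 0 < x)
    (hg : DifferentiableOn ℂ g (re ⁻¹' Icc a b))
    (hC : ∀ s : ℂ, s.re ∈ Icc a b → ‖g s‖ * (1 + |s.im|) ^ 2 ≤ C) :
    mellinInv a g x = mellinInv b g x := by
  obtain ⟨D, hD⟩ := isCompact_Icc.exists_bound_of_continuousOn (s := Icc a b)
    (f := fun u : ℝ => x ^ (-u)) fun u _ =>
      ((Real.continuousAt_const_rpow hx.ne').comp
        (f := fun u => -u) (by fun_prop)).continuousWithinAt
  simp only [mellinInv]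
  congr 1
  refine integral_vertical_eq_of_decay hab (C := D * C)
    (g := fun s => (x : ℂ) ^ (-s) • g s) (DifferentiableOn.fun_smul ?_ hg) fun s hs => ?_
  · exact fun s _ => (DifferentiableAt.const_cpow (by fun_prop)
      (Or.inl (ofReal_ne_zero.2 hx.ne'))).differentiableWithinAt
  · rw [norm_smul, norm_cpow_eq_rpow_re_of_pos hx, mul_assoc]
    refine mul_le_mul ((le_abs_self _).trans (hD _ hs)) (hC s hs) (by positivity) ?_
    exact (norm_nonneg _).trans (hD _ hs)

lemma mellin_ofReal_eq_integral_exp (f : ℝ → ℂ) (σ : ℝ) :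
    mellin f σ = ∫ u : ℝ, Real.exp (-σ * u) • f (Real.exp (-u)) := by
  rw [mellin_eq_fourier, Real.fourier_eq]
  simp

lemma hasCompactSupport_comp_exp_neg (hc : HasCompactSupport f) (h0 : f =ᶠ[𝓝 0] 0) :
    HasCompactSupport fun u : ℝ => f (Real.exp (-u)) := by
  rw [hasCompactSupport_iff_eventuallyEq, coclosedCompact_eq_cocompact, cocompact_eq_atBot_atTop,
    EventuallyEq, eventually_sup] at hc ⊢
  exact ⟨(Real.tendsto_exp_atTop.comp tendsto_neg_atBot_atTop).eventually hc.2,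
    (Real.tendsto_exp_neg_atTop_nhds_zero).eventually h0⟩

lemma integral_norm_mellin_sq (hf : ContDiff ℝ (⊤ : ℕ∞) f) (hc : HasCompactSupport f)
    (h0 : f =ᶠ[𝓝 0] 0) (σ : ℝ) :
    ∫ t : ℝ, ‖mellin f (σ + t * I)‖ ^ 2 =
      2 * Real.pi * ∫ y in Ioi (0 : ℝ), y ^ (2 * σ - 1) * ‖f y‖ ^ 2 := by
  set h : ℝ → ℂ := fun u => Real.exp (-σ * u) • f (Real.exp (-u)) with hh
  have hsupp : HasCompactSupport h :=
    (hasCompactSupport_comp_exp_neg hc h0).mono fun u hu => right_ne_zero_of_smul hu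
  have hsmooth : ContDiff ℝ (⊤ : ℕ∞) h :=
    (Real.contDiff_exp.comp (contDiff_const.mul contDiff_id)).smul
      (hf.comp (Real.contDiff_exp.comp contDiff_neg))
  have plancherel : ∫ ξ, ‖𝓕 h ξ‖ ^ 2 = ∫ u, ‖h u‖ ^ 2 :=
    SchwartzMap.integral_norm_sq_fourier (hsupp.toSchwartzMap hsmooth)
  have hfourier : ∀ t : ℝ, mellin f (σ + t * I) = 𝓕 h (t / (2 * Real.pi)) := fun t => by
    rw [mellin_eq_fourier]
    simp [hh]
  have hsq : ∀ u : ℝ, ((‖h u‖ ^ 2 : ℝ) : ℂ) =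
      Real.exp (-(2 * σ) * u) • ((‖f (Real.exp (-u))‖ ^ 2 : ℝ) : ℂ) := fun u => by
    rw [real_smul, ← ofReal_mul, norm_smul, mul_pow, Real.norm_eq_abs, Real.abs_exp,
      ← Real.exp_nat_mul]
    congr 3
    push_cast
    ring
  have hsubst : ∫ u, ‖h u‖ ^ 2 = ∫ y in Ioi (0 : ℝ), y ^ (2 * σ - 1) * ‖f y‖ ^ 2 := by
    rw [← ofReal_inj, ← integral_complex_ofReal, ← integral_complex_ofReal]
    simp only [hsq]
    rw [← mellin_ofReal_eq_integral_exp (fun y => ((‖f y‖ ^ 2 : ℝ) : ℂ)) (2 * σ), mellin]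
    refine setIntegral_congr_fun measurableSet_Ioi fun y hy => ?_
    simp only [smul_eq_mul, ofReal_mul, ofReal_cpow (le_of_lt hy), ofReal_sub, ofReal_one]
  simp only [hfourier]
  rw [Measure.integral_comp_div fun ξ => ‖𝓕 h ξ‖ ^ 2, abs_of_pos Real.two_pi_pos,
    smul_eq_mul, plancherel, hsubst]

lemma isBigO_atTop_of_hasCompactSupport (hc : HasCompactSupport f) (g : ℝ → ℝ) :
    f =O[atTop] g := by
  rw [hasCompactSupport_iff_eventuallyEq, coclosedCompact_eq_cocompact] at hc
  exact (hc.filter_mono atTop_le_cocompact).trans_isBigO (Asymptotics.isBigO_zero _ _)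

lemma isBigO_zero_of_eventuallyEq_zero (h0 : f =ᶠ[𝓝 0] 0) (g : ℝ → ℝ) : f =O[𝓝[>] 0] g :=
  (h0.filter_mono nhdsWithin_le_nhds).trans_isBigO (Asymptotics.isBigO_zero _ _)

lemma mellinConvergent_of_hasCompactSupport (hf : Continuous f) (hc : HasCompactSupport f)
    (h0 : f =ᶠ[𝓝 0] 0) (s : ℂ) : MellinConvergent f s :=
  mellinConvergent_of_isBigO_rpow (a := s.re + 1) (b := s.re - 1)
    (hf.locallyIntegrable.locallyIntegrableOn _) (isBigO_atTop_of_hasCompactSupport hc _)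
    (by linarith) (isBigO_zero_of_eventuallyEq_zero h0 _) (by linarith)

lemma differentiable_mellin_of_hasCompactSupport (hf : Continuous f) (hc : HasCompactSupport f)
    (h0 : f =ᶠ[𝓝 0] 0) : Differentiable ℂ (mellin f) := fun s =>
  mellin_differentiableAt_of_isBigO_rpow (a := s.re + 1) (b := s.re - 1)
    (hf.locallyIntegrable.locallyIntegrableOn _) (isBigO_atTop_of_hasCompactSupport hc _)
    (by linarith) (isBigO_zero_of_eventuallyEq_zero h0 _) (by linarith)

lemma norm_LSeries_term_vertical (a : ℕ → ℂ) (σ t : ℝ) (n : ℕ) :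
    ‖LSeries.term a (σ + t * I) n‖ = ‖LSeries.term a σ n‖ := by
  simp [LSeries.norm_term_eq]

lemma cpow_neg_mul_LSeries_term {a : ℕ → ℂ} {n : ℕ} (hn : n ≠ 0) (hx : 0 < x) (s : ℂ) :
    (x : ℂ) ^ (-s) * LSeries.term a s n = a n * ((n * x : ℝ) : ℂ) ^ (-s) := by
  rw [LSeries.term_of_ne_zero hn, ofReal_mul, mul_cpow_ofReal_nonneg n.cast_nonneg hx.le,
    ofReal_natCast, cpow_neg (n : ℂ), div_eq_mul_inv]
  ring

lemma continuous_LSeries_term_vertical (a : ℕ → ℂ) (σ : ℝ) (n : ℕ) :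
    Continuous fun t : ℝ => LSeries.term a (σ + t * I) n := by
  rcases eq_or_ne n 0 with rfl | hn
  · simpa only [LSeries.term_zero] using continuous_const
  · simp only [LSeries.term_of_ne_zero hn]
    refine continuous_const.div (Continuous.const_cpow (by fun_prop)
      (Or.inl (Nat.cast_ne_zero.2 hn))) fun t => ?_
    simp [cpow_eq_zero_iff, hn]

lemma hasSum_mellinInv_LSeries_mul_mellin {a : ℕ → ℂ} (ha : LSeriesSummable a σ)
    (hf : Continuous f) (hf0 : f 0 = 0) (hmellin : MellinConvergent f σ)
    (hvert : VerticalIntegrable (mellin f) σ) (hx : 0 < x) :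
    HasSum (fun n : ℕ => a n * f (n * x)) (mellinInv σ (fun s => LSeries a s * mellin f s) x) := by
  set F : ℕ → ℝ → ℂ := fun n t => LSeries.term a (σ + t * I) n *
    ((x : ℂ) ^ (-((σ : ℂ) + t * I)) * mellin f (σ + t * I)) with hF
  have hnorm : ∀ n t, ‖F n t‖ =
      ‖LSeries.term a σ n‖ * (x ^ (-σ) * ‖mellin f (σ + t * I)‖) := fun n t => by
    rw [hF, norm_mul, norm_LSeries_term_vertical, norm_mul, norm_cpow_neg_vertical hx]
  have hterm : ∀ n : ℕ, (1 / (2 * Real.pi)) • ∫ t, F n t = a n * f (n * x) := fun n => by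
    rcases eq_or_ne n 0 with rfl | hn
    · simp [hF, hf0]
    · have hnx : 0 < n * x := by positivity
      rw [← mellinInv_mellin_eq σ f hnx hmellin hvert hf.continuousAt, mellinInv, mul_smul_comm,
        ← integral_const_mul]
      refine congrArg _ (integral_congr_ae (ae_of_all _ fun t => ?_))
      simp only [hF, smul_eq_mul]
      rw [← mul_assoc (a n), ← cpow_neg_mul_LSeries_term hn hx]
      ring
  have hint : ∀ n, Integrable (F n) := fun n =>
    (verticalIntegrable_cpow_neg_mul hx hvert).bdd_mul
      (continuous_LSeries_term_vertical a σ n).aestronglyMeasurable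
      (ae_of_all _ fun t => (norm_LSeries_term_vertical a σ t n).le)
  have hsummable : Summable fun n => ∫ t, ‖F n t‖ := by
    simp only [hnorm, integral_const_mul]
    exact ha.norm.mul_right _
  have htsum : ∀ t : ℝ, ∑' n, F n t = (x : ℂ) ^ (-((σ : ℂ) + t * I)) •
      (LSeries a (σ + t * I) * mellin f (σ + t * I)) := fun t => by
    rw [tsum_mul_right, smul_eq_mul, ← LSeries]
    ring
  have hsum := (hasSum_integral_of_summable_integral_norm hint hsummable).const_smul
    (1 / (2 * Real.pi))
  simp only [hterm, htsum] at hsum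
  exact hsum

end Mellin

section WindowConcentrated

open MeasureTheory Complex

/-- A family of entire functions `F T` which, uniformly for `T ≥ 1` and in vertical strips, is
bounded and decays faster than any power of `|im s| + T` outside the window `w T ≤ im s ≤ T`. -/
structure WindowConcentrated (w : ℝ) (F : ℝ → ℂ → ℂ) : Prop where
  differentiable : ∀ T, Differentiable ℂ (F T)
  exists_norm_le : ∀ A B : ℝ, ∃ C : ℝ, 0 ≤ C ∧ ∀ T, 1 ≤ T → ∀ s : ℂ, s.re ∈ Icc A B → ‖F T s‖ ≤ C
  exists_norm_mul_pow_le : ∀ (A B : ℝ) (n : ℕ), ∃ C : ℝ, 0 ≤ C ∧ ∀ T, 1 ≤ T → ∀ s : ℂ,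
    s.re ∈ Icc A B → s.im ∉ Icc (w * T) T → ‖F T s‖ * (|s.im| + T) ^ n ≤ C

namespace WindowConcentrated

variable {w σ T : ℝ} {F : ℝ → ℂ → ℂ} {g : ℂ → ℂ}

lemma mul (hF : WindowConcentrated w F) {P : ℂ → ℂ} (hP : Differentiable ℂ P)
    (hPb : ∀ A B : ℝ, ∃ C : ℝ, 0 ≤ C ∧ ∀ s : ℂ, s.re ∈ Icc A B → ‖P s‖ ≤ C) :
    WindowConcentrated w fun T s => P s * F T s where
  differentiable T := hP.mul (hF.differentiable T)
  exists_norm_le A B := by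
    obtain ⟨C, hC, hPC⟩ := hPb A B
    obtain ⟨D, hD, hFD⟩ := hF.exists_norm_le A B
    exact ⟨C * D, mul_nonneg hC hD, fun T hT s hs => norm_mul_le_of_le (hPC s hs) (hFD T hT s hs)⟩
  exists_norm_mul_pow_le A B n := by
    obtain ⟨C, hC, hPC⟩ := hPb A B
    obtain ⟨D, hD, hFD⟩ := hF.exists_norm_mul_pow_le A B n
    refine ⟨C * D, mul_nonneg hC hD, fun T hT s hs him => ?_⟩
    rw [norm_mul, mul_assoc]
    exact mul_le_mul (hPC s hs) (hFD T hT s hs him) (by positivity) hC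

lemma continuous_vertical (hF : WindowConcentrated w F) (T σ : ℝ) :
    Continuous fun t : ℝ => F T (σ + t * I) :=
  (hF.differentiable T).continuous.comp (by fun_prop)

lemma exists_norm_mul_one_add_pow_le (hF : WindowConcentrated w F) (hT : 1 ≤ T) (A B : ℝ) (n : ℕ) :
    ∃ C : ℝ, 0 ≤ C ∧ ∀ s : ℂ, s.re ∈ Icc A B → ‖F T s‖ * (1 + |s.im|) ^ n ≤ C := by
  obtain ⟨C, hC, hFC⟩ := hF.exists_norm_le A B
  obtain ⟨D, hD, hFD⟩ := hF.exists_norm_mul_pow_le A B n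
  have hR : 0 ≤ 1 + (|w * T| + |T|) := by positivity
  refine ⟨max (C * (1 + (|w * T| + |T|)) ^ n) D, le_max_of_le_right hD, fun s hs => ?_⟩
  by_cases him : s.im ∈ Icc (w * T) T
  · have him_le : |s.im| ≤ |w * T| + |T| :=
      (abs_le_max_abs_abs him.1 him.2).trans (max_le_add_of_nonneg (abs_nonneg _) (abs_nonneg _))
    refine le_max_of_le_left ?_
    gcongr
    exact hFC T hT s hs
  · refine le_max_of_le_right (le_trans ?_ (hFD T hT s hs him))
    rw [add_comm]
    gcongr

lemma exists_norm_mul_le_of_growth (hF : WindowConcentrated w F) (hT : 1 ≤ T) {A B K : ℝ} {k : ℕ}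
    (hg : ∀ s : ℂ, s.re ∈ Icc A B → ‖g s‖ ≤ K * (1 + |s.im|) ^ k) :
    ∃ C : ℝ, ∀ s : ℂ, s.re ∈ Icc A B → ‖g s * F T s‖ * (1 + |s.im|) ^ 2 ≤ C := by
  obtain ⟨C, hC, hFC⟩ := hF.exists_norm_mul_one_add_pow_le hT A B (k + 2)
  refine ⟨|K| * C, fun s hs => ?_⟩
  calc ‖g s * F T s‖ * (1 + |s.im|) ^ 2
      ≤ |K| * (1 + |s.im|) ^ k * ‖F T s‖ * (1 + |s.im|) ^ 2 := by
        rw [norm_mul]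
        gcongr
        exact (hg s hs).trans (by gcongr; exact le_abs_self K)
    _ = |K| * (‖F T s‖ * (1 + |s.im|) ^ (k + 2)) := by ring
    _ ≤ |K| * C := by gcongr; exact hFC s hs

lemma verticalIntegrable_mul (hF : WindowConcentrated w F) (hT : 1 ≤ T) {K : ℝ} {k : ℕ}
    (hgc : Continuous fun t : ℝ => g (σ + t * I))
    (hg : ∀ s : ℂ, s.re = σ → ‖g s‖ ≤ K * (1 + |s.im|) ^ k) :
    VerticalIntegrable (fun s => g s * F T s) σ := by
  obtain ⟨C, hC⟩ := hF.exists_norm_mul_le_of_growth hT (A := σ) (B := σ) (by simpa using hg)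
  exact verticalIntegrable_of_decay (hgc.mul (hF.continuous_vertical T σ)) (C := C)
    fun t => by simpa using hC (σ + t * I) (by simp)

lemma verticalIntegrable (hF : WindowConcentrated w F) (hT : 1 ≤ T) (σ : ℝ) :
    VerticalIntegrable (F T) σ := by
  simpa using hF.verticalIntegrable_mul hT (σ := σ) (g := fun _ => 1) (K := 1) (k := 0)
    continuous_const (by simp)

lemma integrable_norm_sq (hF : WindowConcentrated w F) (hT : 1 ≤ T) (σ : ℝ) :
    Integrable fun t : ℝ => ‖F T (σ + t * I)‖ ^ 2 := by
  obtain ⟨C, -, hFC⟩ := hF.exists_norm_le σ σ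
  have hsq := hF.verticalIntegrable_mul hT (σ := σ) (g := F T) (K := C) (k := 0)
    (hF.continuous_vertical T σ) (by simpa using hFC T hT)
  simpa only [← sq, norm_pow] using hsq.norm

lemma setIntegral_norm_le (hF : WindowConcentrated w F) (hT : 1 ≤ T) (hw : w ≤ 1) (σ : ℝ) :
    ∫ t in Icc (w * T) T, ‖F T (σ + t * I)‖ ≤
      √((1 - w) * T) * √(∫ t : ℝ, ‖F T (σ + t * I)‖ ^ 2) := by
  have hcont := (hF.continuous_vertical T σ).norm
  have hvol : volume.real (Icc (w * T) T) = (1 - w) * T := by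
    rw [Real.volume_real_Icc_of_le (mul_le_of_le_one_left (by linarith) hw)]
    ring
  have cauchySchwarz := integral_mul_le_Lp_mul_Lq_of_nonneg
    (μ := volume.restrict (Icc (w * T) T)) (f := fun _ => (1 : ℝ))
    (g := fun t => ‖F T (σ + t * I)‖) Real.HolderConjugate.two_two
    (ae_of_all _ fun _ => zero_le_one) (ae_of_all _ fun _ => norm_nonneg _) (memLp_const _) (by
      rw [ENNReal.ofReal_ofNat, memLp_two_iff_integrable_sq hcont.aestronglyMeasurable]
      exact (hF.integrable_norm_sq hT σ).integrableOn)
  simp only [one_mul, integral_const, measureReal_restrict_apply_univ, hvol, smul_eq_mul,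
    Real.rpow_two, one_pow, mul_one, ← Real.sqrt_eq_rpow] at cauchySchwarz
  refine cauchySchwarz.trans (mul_le_mul_of_nonneg_left (Real.sqrt_le_sqrt ?_) (Real.sqrt_nonneg _))
  exact setIntegral_le_integral (hF.integrable_norm_sq hT σ) (ae_of_all _ fun t => by positivity)

lemma exists_norm_mul_le_indicator_add (hF : WindowConcentrated w F) (σ : ℝ) {K : ℝ} {k : ℕ}
    (hg : ∀ s : ℂ, s.re = σ → ‖g s‖ ≤ K * (1 + |s.im|) ^ k) :
    ∃ C : ℝ, 0 ≤ C ∧ ∀ T, 1 ≤ T → ∀ M : ℝ, (∀ t ∈ Icc (w * T) T, ‖g (σ + t * I)‖ ≤ M) →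
      ∀ t : ℝ, ‖g (σ + t * I) * F T (σ + t * I)‖ ≤
        indicator (Icc (w * T) T) (fun t : ℝ => M * ‖F T (σ + t * I)‖) t +
          C / T * (1 + t ^ 2)⁻¹ := by
  obtain ⟨C, hC, hFC⟩ := hF.exists_norm_mul_pow_le σ σ (k + 3)
  refine ⟨|K| * C, by positivity, fun T hT M hM t => ?_⟩
  have hT0 : 0 < T := zero_lt_one.trans_le hT
  by_cases ht : t ∈ Icc (w * T) T
  · rw [indicator_of_mem ht, norm_mul]
    exact le_add_of_le_of_nonneg (by gcongr; exact hM t ht) (by positivity)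
  have hgt : ‖g (σ + t * I)‖ ≤ |K| * (|t| + T) ^ k := by
    have hle : 1 + |((σ : ℂ) + t * I).im| ≤ |t| + T := by
      simpa using (by linarith : 1 + |t| ≤ |t| + T)
    exact (hg _ (by simp)).trans (by gcongr; exact le_abs_self K)
  have hFt := hFC T hT (σ + t * I) (by simp) (by simpa using ht)
  rw [indicator_of_notMem ht, zero_add, ← div_eq_mul_inv, div_div, le_div_iff₀ (by positivity)]
  calc ‖g (σ + t * I) * F T (σ + t * I)‖ * (T * (1 + t ^ 2))
      ≤ |K| * (|t| + T) ^ k * ‖F T (σ + t * I)‖ * ((|t| + T) * (|t| + T) ^ 2) := by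
        rw [norm_mul]
        gcongr
        · linarith [abs_nonneg t]
        · nlinarith [abs_nonneg t, sq_abs t]
    _ = |K| * (‖F T (σ + t * I)‖ * (|t| + T) ^ (k + 3)) := by ring
    _ ≤ |K| * C := by gcongr; simpa using hFt

lemma exists_norm_mellinInv_mul_le (hF : WindowConcentrated w F) (hw : w ≤ 1) (σ : ℝ) {K : ℝ}
    {k : ℕ} (hg : ∀ s : ℂ, s.re = σ → ‖g s‖ ≤ K * (1 + |s.im|) ^ k) :
    ∃ C : ℝ, 0 ≤ C ∧ ∀ T, 1 ≤ T → ∀ M : ℝ, 0 ≤ M →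
      (∀ t ∈ Icc (w * T) T, ‖g (σ + t * I)‖ ≤ M) → ∀ x : ℝ, 0 < x →
      ‖mellinInv σ (fun s => g s * F T s) x‖ ≤ x ^ (-σ) / (2 * Real.pi) *
        (M * (√((1 - w) * T) * √(∫ t : ℝ, ‖F T (σ + t * I)‖ ^ 2)) + C / T) := by
  obtain ⟨C, hC, hbound⟩ := hF.exists_norm_mul_le_indicator_add σ hg
  refine ⟨C * ∫ t : ℝ, (1 + t ^ 2)⁻¹, mul_nonneg hC (integral_nonneg fun t => by positivity),
    fun T hT M hM hgM x hx => (norm_mellinInv_le hx σ _).trans ?_⟩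
  have hwindow : Integrable (indicator (Icc (w * T) T) fun t : ℝ => M * ‖F T (σ + t * I)‖) :=
    ((hF.verticalIntegrable hT σ).norm.const_mul M).indicator measurableSet_Icc
  have htail := integrable_inv_one_add_sq.const_mul (C / T)
  gcongr
  calc ∫ t : ℝ, ‖g (σ + t * I) * F T (σ + t * I)‖
      ≤ ∫ t : ℝ, (indicator (Icc (w * T) T) (fun t : ℝ => M * ‖F T (σ + t * I)‖) t +
          C / T * (1 + t ^ 2)⁻¹) :=
        integral_mono_of_nonneg (ae_of_all _ fun t => norm_nonneg _) (hwindow.add htail)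
          (ae_of_all _ (hbound T hT M hgM))
    _ = M * (∫ t in Icc (w * T) T, ‖F T (σ + t * I)‖) + C * (∫ t : ℝ, (1 + t ^ 2)⁻¹) / T := by
        rw [integral_add hwindow htail, integral_indicator measurableSet_Icc, integral_const_mul,
          integral_const_mul, div_mul_eq_mul_div]
    _ ≤ _ := by gcongr; exact hF.setIntegral_norm_le hT hw σ

end WindowConcentrated

end WindowConcentrated

section ZetaVertical

open MeasureTheory Complex

variable {σ : ℝ}

lemma HasPolynomialGrowth.exists_norm_le_one_add_abs_im_pow {a A : ℝ} {f : ℂ → ℂ}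
    (hf : HasPolynomialGrowth a f) (hA : a < A) (B : ℝ) :
    ∃ K : ℝ, 0 ≤ K ∧ ∃ k : ℕ, ∀ s : ℂ, s.re ∈ Icc A B → ‖f s‖ ≤ K * (1 + |s.im|) ^ k := by
  obtain ⟨C, hC, k, hk⟩ := hf.exists_norm_le A hA
  refine ⟨C * (1 + (|A| + |B|)) ^ k, by positivity, k, fun s hs => (hk s hs.1).trans ?_⟩
  have hre : |s.re| ≤ |A| + |B| :=
    (abs_le_max_abs_abs hs.1 hs.2).trans (max_le_add_of_nonneg (abs_nonneg _) (abs_nonneg _))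
  rw [mul_assoc, ← mul_pow]
  gcongr
  nlinarith [norm_le_abs_re_add_abs_im s, abs_nonneg s.im, abs_nonneg s.re]

lemma ne_one_of_re_ne_one {s : ℂ} (hs : s.re ≠ 1) : s ≠ 1 := fun h => hs (by rw [h, one_re])

lemma continuous_zetaPrincipalPart_vertical (ℓ : ℕ) (hσ : σ ≠ 1) :
    Continuous fun t : ℝ => zetaPrincipalPart ℓ (σ + t * I) :=
  continuous_const.div (by fun_prop) fun t =>
    pow_ne_zero _ (sub_ne_zero.2 (ne_one_of_re_ne_one (by simpa using hσ)))

lemma continuous_iteratedDeriv_riemannZeta₀ (ℓ : ℕ) : Continuous (iteratedDeriv ℓ riemannZeta₀) :=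
  differentiable_riemannZeta₀.contDiff.continuous_iteratedDeriv ℓ le_top

lemma continuous_iteratedDeriv_riemannZeta_vertical (ℓ : ℕ) (hσ : σ ≠ 1) :
    Continuous fun t : ℝ => iteratedDeriv ℓ riemannZeta (σ + t * I) := by
  have hne : ∀ t : ℝ, (σ : ℂ) + t * I ≠ 1 := fun t => ne_one_of_re_ne_one (by simpa using hσ)
  simp only [fun t => iteratedDeriv_riemannZeta_eq ℓ (hne t)]
  exact (continuous_zetaPrincipalPart_vertical ℓ hσ).add
    ((continuous_iteratedDeriv_riemannZeta₀ ℓ).comp (by fun_prop))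

lemma exists_norm_zetaPrincipalPart_le (ℓ : ℕ) (hσ : σ ≠ 1) :
    ∃ K : ℝ, 0 ≤ K ∧ ∀ s : ℂ, s.re = σ → ‖zetaPrincipalPart ℓ s‖ ≤ K / (1 + |s.im|) := by
  have hσ' : 0 < |σ - 1| := abs_pos.2 (sub_ne_zero.2 hσ)
  refine ⟨ℓ.factorial / |σ - 1| ^ ℓ * (1 + |σ - 1|⁻¹), by positivity, fun s hs => ?_⟩
  have hre : |σ - 1| ≤ ‖s - 1‖ := by simpa [hs] using abs_re_le_norm (s - 1)
  have him : |s.im| ≤ ‖s - 1‖ := by simpa using abs_im_le_norm (s - 1)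
  have hone : 1 + |s.im| ≤ (1 + |σ - 1|⁻¹) * ‖s - 1‖ := by
    have : |σ - 1|⁻¹ * |σ - 1| ≤ |σ - 1|⁻¹ * ‖s - 1‖ := by gcongr
    rw [inv_mul_cancel₀ hσ'.ne'] at this
    linarith
  have hnorm : ‖zetaPrincipalPart ℓ s‖ = ℓ.factorial / (‖s - 1‖ ^ ℓ * ‖s - 1‖) := by
    simp [zetaPrincipalPart, pow_succ]
  rw [hnorm, le_div_iff₀ (by positivity), div_mul_eq_mul_div,
    div_le_iff₀ (mul_pos (pow_pos (hσ'.trans_le hre) _) (hσ'.trans_le hre))]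
  calc ℓ.factorial * (1 + |s.im|)
      ≤ ℓ.factorial * ((1 + |σ - 1|⁻¹) * ‖s - 1‖) := by gcongr
    _ = ℓ.factorial / |σ - 1| ^ ℓ * (1 + |σ - 1|⁻¹) * (|σ - 1| ^ ℓ * ‖s - 1‖) := by
        field_simp
    _ ≤ _ := by gcongr

lemma exists_norm_iteratedDeriv_riemannZeta_le (ℓ : ℕ) (hσ : σ ≠ 1) :
    ∃ (K : ℝ) (k : ℕ), ∀ s : ℂ, s.re = σ →
      ‖iteratedDeriv ℓ riemannZeta s‖ ≤ K * (1 + |s.im|) ^ k := by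
  obtain ⟨K₁, hK₁, hpole⟩ := exists_norm_zetaPrincipalPart_le ℓ hσ
  obtain ⟨K₂, -, k, hentire⟩ := ((hasPolynomialGrowth_riemannZeta₀ (σ - 1)).iteratedDeriv ℓ
    ).exists_norm_le_one_add_abs_im_pow (sub_one_lt σ) σ
  refine ⟨K₁ + K₂, k, fun s hs => ?_⟩
  have one_le : 1 ≤ 1 + |s.im| := le_add_of_nonneg_right (abs_nonneg _)
  rw [iteratedDeriv_riemannZeta_eq ℓ (ne_one_of_re_ne_one (hs.trans_ne hσ)), add_mul]
  refine norm_add_le_of_le ((hpole s hs).trans ?_) (hentire s (by simp [hs]))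
  exact (div_le_self hK₁ one_le).trans (le_mul_of_one_le_right hK₁ (one_le_pow₀ one_le))

namespace WindowConcentrated

variable {w E E' : ℝ} {F : ℝ → ℂ → ℂ}

lemma exists_norm_mellinInv_zetaPrincipalPart_le (hF : WindowConcentrated w F) (hw0 : 0 < w)
    (hw : w ≤ 1) (ℓ : ℕ) (hσ : σ ≠ 1) (hE : ∀ T, 1 ≤ T → ∫ t : ℝ, ‖F T (σ + t * I)‖ ^ 2 ≤ E) :
    ∃ C : ℝ, 0 ≤ C ∧ ∀ T, 1 ≤ T → ∀ x : ℝ, 0 < x →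
      ‖mellinInv σ (fun s => zetaPrincipalPart ℓ s * F T s) x‖ ≤ x ^ (-σ) * (C / √T) := by
  obtain ⟨K, hK, hpole⟩ := exists_norm_zetaPrincipalPart_le ℓ hσ
  obtain ⟨C, hC, hmain⟩ := hF.exists_norm_mellinInv_mul_le hw σ (g := zetaPrincipalPart ℓ)
    (K := K) (k := 0) fun s hs => (hpole s hs).trans (by
      rw [pow_zero, mul_one]
      exact div_le_self hK (le_add_of_nonneg_right (abs_nonneg _)))
  refine ⟨(K / w * (√(1 - w) * √E) + C) / (2 * Real.pi), by positivity, fun T hT x hx => ?_⟩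
  have hT0 : 0 < T := zero_lt_one.trans_le hT
  have hwindow : ∀ t ∈ Icc (w * T) T, ‖zetaPrincipalPart ℓ (σ + t * I)‖ ≤ K / (w * T) := by
    refine fun t ht => (hpole _ (by simp)).trans ?_
    gcongr
    simpa using (le_abs_self t).trans' ht.1 |>.trans (le_add_of_nonneg_left zero_le_one)
  have hsqrt : √T / T = 1 / √T := Real.sqrt_div_self'
  have hsqrt_le : C / T ≤ C / √T := by
    gcongr
    exact Real.sqrt_le_self_iff.2 (Or.inr hT)
  calc ‖mellinInv σ (fun s => zetaPrincipalPart ℓ s * F T s) x‖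
      ≤ x ^ (-σ) / (2 * Real.pi) *
        (K / (w * T) * (√((1 - w) * T) * √(∫ t : ℝ, ‖F T (σ + t * I)‖ ^ 2)) + C / T) :=
        hmain T hT _ (by positivity) hwindow x hx
    _ ≤ x ^ (-σ) / (2 * Real.pi) * (K / (w * T) * (√(1 - w) * √T * √E) + C / √T) := by
        rw [Real.sqrt_mul (by linarith)]
        gcongr
        exact hE T hT
    _ = x ^ (-σ) / (2 * Real.pi) * (K / w * (√(1 - w) * √E) * (√T / T) + C / √T) := by
        field_simp
    _ = _ := by
        rw [hsqrt]
        ring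

lemma mellinInv_iteratedDeriv_riemannZeta_eq_add (hF : WindowConcentrated w F) (ℓ : ℕ)
    (hσ : σ ≠ 1) {T : ℝ} (hT : 1 ≤ T) {x : ℝ} (hx : 0 < x) :
    mellinInv σ (fun s => iteratedDeriv ℓ riemannZeta s * F T s) x =
      mellinInv σ (fun s => zetaPrincipalPart ℓ s * F T s) x +
        mellinInv σ (fun s => iteratedDeriv ℓ riemannZeta₀ s * F T s) x := by
  obtain ⟨K₁, hK₁, hpole⟩ := exists_norm_zetaPrincipalPart_le ℓ hσ
  obtain ⟨K₂, -, k, hentire⟩ := ((hasPolynomialGrowth_riemannZeta₀ (σ - 1)).iteratedDeriv ℓ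
    ).exists_norm_le_one_add_abs_im_pow (sub_one_lt σ) σ
  rw [← mellinInv_add hx]
  · simp only [mellinInv]
    refine congrArg _ (integral_congr_ae (ae_of_all _ fun t => ?_))
    simp only [iteratedDeriv_riemannZeta_eq ℓ
      (ne_one_of_re_ne_one (s := σ + t * I) (by simpa using hσ)), add_mul]
  · refine hF.verticalIntegrable_mul hT (K := K₁) (k := 0)
      (continuous_zetaPrincipalPart_vertical ℓ hσ) fun s hs => (hpole s hs).trans ?_
    rw [pow_zero, mul_one]
    exact div_le_self hK₁ (le_add_of_nonneg_right (abs_nonneg _))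
  · exact hF.verticalIntegrable_mul hT
      ((continuous_iteratedDeriv_riemannZeta₀ ℓ).comp (by fun_prop))
      fun s hs => hentire s (by simp [hs])

lemma mellinInv_iteratedDeriv_riemannZeta₀_eq (hF : WindowConcentrated w F) (ℓ : ℕ) {a b : ℝ}
    (hab : a ≤ b) {T : ℝ} (hT : 1 ≤ T) {x : ℝ} (hx : 0 < x) :
    mellinInv a (fun s => iteratedDeriv ℓ riemannZeta₀ s * F T s) x =
      mellinInv b (fun s => iteratedDeriv ℓ riemannZeta₀ s * F T s) x := by
  have hgrowth := (hasPolynomialGrowth_riemannZeta₀ (a - 1)).iteratedDeriv ℓ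
  obtain ⟨K, -, k, hentire⟩ := hgrowth.exists_norm_le_one_add_abs_im_pow (sub_one_lt a) b
  obtain ⟨C, hC⟩ := hF.exists_norm_mul_le_of_growth hT hentire
  refine mellinInv_eq_of_decay hab hx (DifferentiableOn.mul ?_
    (hF.differentiable T).differentiableOn) hC
  exact hgrowth.differentiableOn.mono fun s hs => (sub_one_lt a).trans_le hs.1

lemma exists_norm_mellinInv_iteratedDeriv_riemannZeta_le (hF : WindowConcentrated w F)
    (hw0 : 0 < w) (hw : w ≤ 1) (ℓ : ℕ) {b : ℝ} (hσ : σ < 1) (hb : 1 < b)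
    (hE : ∀ T, 1 ≤ T → ∫ t : ℝ, ‖F T (σ + t * I)‖ ^ 2 ≤ E)
    (hEb : ∀ T, 1 ≤ T → ∫ t : ℝ, ‖F T (b + t * I)‖ ^ 2 ≤ E') :
    ∃ C : ℝ, 0 ≤ C ∧ ∀ T, 1 ≤ T → ∀ M : ℝ, 0 ≤ M →
      (∀ t ∈ Icc (w * T) T, ‖iteratedDeriv ℓ riemannZeta (σ + t * I)‖ ≤ M) →
      ∀ x : ℝ, 0 < x → x ≤ 1 →
      ‖mellinInv b (fun s => iteratedDeriv ℓ riemannZeta s * F T s) x‖ ≤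
        x ^ (-σ) / (2 * Real.pi) * (M * (√((1 - w) * T) * √E)) + x ^ (-b) * (C / √T) := by
  obtain ⟨K, k, hgrowth⟩ := exists_norm_iteratedDeriv_riemannZeta_le ℓ hσ.ne
  obtain ⟨C, hC, hzeta⟩ := hF.exists_norm_mellinInv_mul_le hw σ hgrowth
  obtain ⟨Cσ, hCσ, hpoleσ⟩ := hF.exists_norm_mellinInv_zetaPrincipalPart_le hw0 hw ℓ hσ.ne hE
  obtain ⟨Cb, hCb, hpoleb⟩ := hF.exists_norm_mellinInv_zetaPrincipalPart_le hw0 hw ℓ hb.ne' hEb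
  refine ⟨C / (2 * Real.pi) + Cσ + Cb, by positivity, fun T hT M hM hMζ x hx hx1 => ?_⟩
  have hxσ : x ^ (-σ) ≤ x ^ (-b) :=
    Real.rpow_le_rpow_of_exponent_ge hx hx1 (by linarith)
  have hshift : mellinInv b (fun s => iteratedDeriv ℓ riemannZeta s * F T s) x =
      mellinInv σ (fun s => iteratedDeriv ℓ riemannZeta s * F T s) x -
        mellinInv σ (fun s => zetaPrincipalPart ℓ s * F T s) x +
        mellinInv b (fun s => zetaPrincipalPart ℓ s * F T s) x := by
    rw [hF.mellinInv_iteratedDeriv_riemannZeta_eq_add ℓ hb.ne' hT hx,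
      hF.mellinInv_iteratedDeriv_riemannZeta_eq_add ℓ hσ.ne hT hx,
      hF.mellinInv_iteratedDeriv_riemannZeta₀_eq ℓ (hσ.trans hb).le hT hx]
    ring
  have hsqrt_le : C / T ≤ C / √T := by
    gcongr
    exact Real.sqrt_le_self_iff.2 (Or.inr hT)
  calc ‖mellinInv b (fun s => iteratedDeriv ℓ riemannZeta s * F T s) x‖
      ≤ x ^ (-σ) / (2 * Real.pi) *
          (M * (√((1 - w) * T) * √(∫ t : ℝ, ‖F T (σ + t * I)‖ ^ 2)) + C / T) +
          x ^ (-σ) * (Cσ / √T) + x ^ (-b) * (Cb / √T) := by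
        rw [hshift]
        exact norm_add_le_of_le (norm_sub_le_of_le (hzeta T hT M hM hMζ x hx) (hpoleσ T hT x hx))
          (hpoleb T hT x hx)
    _ ≤ x ^ (-σ) / (2 * Real.pi) * (M * (√((1 - w) * T) * √E)) +
          (x ^ (-b) / (2 * Real.pi) * (C / √T) + x ^ (-b) * (Cσ / √T) + x ^ (-b) * (Cb / √T)) := by
        rw [mul_add, add_assoc, add_assoc, add_assoc]
        gcongr
        exact hE T hT
    _ = _ := by ring

end WindowConcentrated

end ZetaVertical

section NonStationaryPhase

open MeasureTheory Complex

/-- The integrand `y ^ (s - 1) * exp (-i T y)` of an oscillatory Mellin transform; its phase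
`im s * log y - T * y` has logarithmic derivative `im s - T * y`. -/
noncomputable def oscKernel (s : ℂ) (T y : ℝ) : ℂ := (y : ℂ) ^ (s - 1) * exp (-(T * y * I))

/-- The oscillatory integral over `[y₀, y₁]` of an amplitude `b` against the `j`-th power of the
reciprocal of `s - i T y`, the factor that each integration by parts produces. -/
noncomputable def oscIntegral (y₀ y₁ : ℝ) (s : ℂ) (T : ℝ) (b : ℝ → ℂ) (j : ℕ) : ℂ :=
  ∫ y in y₀..y₁, b y * (s - T * y * I)⁻¹ ^ j * oscKernel s T y

variable {y₀ y₁ T : ℝ} {s : ℂ} {b : ℝ → ℂ}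

lemma hasDerivAt_mul_oscKernel (s : ℂ) (T : ℝ) {y : ℝ} (hy : 0 < y) :
    HasDerivAt (fun y : ℝ => y * oscKernel s T y) ((s - T * y * I) * oscKernel s T y) y := by
  have hpow : HasDerivAt (fun z : ℂ => z ^ (s - 1)) ((s - 1) * (y : ℂ) ^ (s - 1 - 1)) y := by
    simpa using (hasDerivAt_id (y : ℂ)).cpow_const (c := s - 1) (Or.inl (by simpa using hy))
  have hexp : HasDerivAt (fun z : ℂ => exp (-(T * z * I))) (exp (-(T * y * I)) * -(T * I)) y := by
    refine HasDerivAt.cexp ?_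
    simpa using (((hasDerivAt_id (y : ℂ)).const_mul (T : ℂ)).mul_const I).fun_neg
  refine ((hasDerivAt_id (y : ℂ)).mul (hpow.mul hexp)).comp_ofReal.congr_deriv ?_
  have hsucc : (y : ℂ) * (y : ℂ) ^ (s - 1 - 1) = (y : ℂ) ^ (s - 1) := by
    rw [cpow_sub _ _ (ofReal_ne_zero.2 hy.ne'), cpow_one,
      mul_div_cancel₀ _ (ofReal_ne_zero.2 hy.ne')]
  simp only [oscKernel, id, Pi.mul_apply]
  linear_combination (s - 1) * exp (-(T * y * I)) * hsucc

lemma hasDerivAt_mul_inv_pow {y : ℝ} (hb : DifferentiableAt ℝ b y) (hq : s - T * y * I ≠ 0)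
    (j : ℕ) :
    HasDerivAt (fun y : ℝ => b y * (s - T * y * I)⁻¹ ^ (j + 1))
      (deriv b y * (s - T * y * I)⁻¹ ^ (j + 1) +
        b y * ((j + 1) * (T * I) * (s - T * y * I)⁻¹ ^ (j + 2))) y := by
  have hphase : HasDerivAt (fun y : ℝ => s - T * y * I) (-(T * I)) y := by
    simpa using (((ofRealCLM.hasDerivAt (x := y)).const_mul (T : ℂ)).mul_const I).const_sub s
  refine hb.hasDerivAt.mul (((hphase.inv hq).pow (j + 1)).congr_deriv ?_)
  simp only [Pi.inv_apply, Nat.cast_add, Nat.cast_one, add_tsub_cancel_right, neg_neg,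
    div_eq_mul_inv, ← inv_pow]
  ring

lemma continuousOn_oscKernel (h0 : 0 < y₀) (s : ℂ) (T : ℝ) :
    ContinuousOn (oscKernel s T) (Icc y₀ y₁) :=
  (ContinuousOn.cpow_const (by fun_prop) fun _ hy => Or.inl (h0.trans_le hy.1)).mul (by fun_prop)

lemma norm_oscKernel (s : ℂ) (T : ℝ) {y : ℝ} (hy : 0 < y) :
    ‖oscKernel s T y‖ = y ^ (s.re - 1) := by
  simp [oscKernel, norm_cpow_eq_rpow_re_of_pos hy, norm_exp]

lemma continuousOn_oscIntegrand (h0 : 0 < y₀) (hb : Continuous b)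
    (hq : ∀ y ∈ Icc y₀ y₁, s - T * y * I ≠ 0) (j : ℕ) :
    ContinuousOn (fun y : ℝ => b y * (s - T * y * I)⁻¹ ^ j * oscKernel s T y) (Icc y₀ y₁) :=
  (hb.continuousOn.mul ((ContinuousOn.inv₀ (by fun_prop) hq).pow j)).mul
    (continuousOn_oscKernel h0 s T)

lemma integral_oscIntegrand_add {c : ℝ → ℂ} (h0 : 0 < y₀) (h01 : y₀ ≤ y₁) (hb : Continuous b)
    (hc : Continuous c) (hq : ∀ y ∈ Icc y₀ y₁, s - T * y * I ≠ 0) (j : ℕ) :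
    ∫ y in y₀..y₁, (b y * (s - T * y * I)⁻¹ ^ (j + 1) +
      c y * ((j + 1) * (T * I) * (s - T * y * I)⁻¹ ^ (j + 2))) * (y * oscKernel s T y) =
      oscIntegral y₀ y₁ s T (fun y => b y * y) (j + 1) +
        (j + 1) * (T * I) * oscIntegral y₀ y₁ s T (fun y => c y * y) (j + 2) := by
  have hint : ∀ {a : ℝ → ℂ} (_ : Continuous a) (k : ℕ), IntervalIntegrable
      (fun y : ℝ => a y * y * (s - T * y * I)⁻¹ ^ k * oscKernel s T y) volume y₀ y₁ :=
    fun {a} ha k => ContinuousOn.intervalIntegrable (by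
      rw [uIcc_of_le h01]
      exact continuousOn_oscIntegrand h0 (b := fun y => a y * y) (by fun_prop) hq k)
  rw [oscIntegral, oscIntegral, ← intervalIntegral.integral_const_mul,
    ← intervalIntegral.integral_add (hint hb _) ((hint hc _).const_mul _)]
  refine intervalIntegral.integral_congr fun y _ => ?_
  ring

lemma oscIntegral_by_parts (h0 : 0 < y₀) (h01 : y₀ ≤ y₁) (hb : ContDiff ℝ 1 b) (hb0 : b y₀ = 0)
    (hb1 : b y₁ = 0) (hq : ∀ y ∈ Icc y₀ y₁, s - T * y * I ≠ 0) (j : ℕ) :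
    oscIntegral y₀ y₁ s T b j = -oscIntegral y₀ y₁ s T (fun y => deriv b y * y) (j + 1) -
      (j + 1) * (T * I) * oscIntegral y₀ y₁ s T (fun y => b y * y) (j + 2) := by
  have hb' : Continuous (deriv b) := hb.continuous_deriv le_rfl
  have hint : ∀ {g : ℝ → ℂ}, ContinuousOn g (Icc y₀ y₁) → IntervalIntegrable g volume y₀ y₁ :=
    fun hg => ContinuousOn.intervalIntegrable (by rwa [uIcc_of_le h01])
  have hinv : ContinuousOn (fun y : ℝ => (s - T * y * I)⁻¹) (Icc y₀ y₁) :=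
    ContinuousOn.inv₀ (by fun_prop) hq
  have parts := intervalIntegral.integral_mul_deriv_eq_deriv_mul (a := y₀) (b := y₁)
    (fun y hy => hasDerivAt_mul_inv_pow (hb.differentiable one_ne_zero).differentiableAt
      (hq y (by rwa [uIcc_of_le h01] at hy)) j)
    (fun y hy => hasDerivAt_mul_oscKernel s T
      (h0.trans_le (by rw [uIcc_of_le h01] at hy; exact hy.1)))
    (hint ((hb'.continuousOn.mul (hinv.pow _)).add
      (hb.continuous.continuousOn.mul (continuousOn_const.mul (hinv.pow _)))))
    (hint (ContinuousOn.mul (by fun_prop) (continuousOn_oscKernel h0 s T)))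
  have hlhs : ∫ y in y₀..y₁, b y * (s - T * y * I)⁻¹ ^ (j + 1) *
      ((s - T * y * I) * oscKernel s T y) = oscIntegral y₀ y₁ s T b j := by
    refine intervalIntegral.integral_congr fun y hy => ?_
    rw [uIcc_of_le h01] at hy
    have := hq y hy
    simp only [pow_succ]
    field_simp
  rw [hlhs, integral_oscIntegrand_add h0 h01 hb' hb.continuous hq, hb0, hb1] at parts
  rw [parts]
  ring

lemma exists_norm_oscKernel_le (h0 : 0 < y₀) (y₁ A B : ℝ) :
    ∃ C, 0 ≤ C ∧ ∀ (s : ℂ) (T : ℝ), s.re ∈ Icc A B → ∀ y ∈ Icc y₀ y₁, ‖oscKernel s T y‖ ≤ C := by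
  obtain ⟨C, hC⟩ := (isCompact_Icc.prod isCompact_Icc).exists_bound_of_continuousOn
    (f := fun p : ℝ × ℝ => p.2 ^ (p.1 - 1)) (s := Icc A B ×ˢ Icc y₀ y₁)
    (ContinuousOn.rpow (by fun_prop) (by fun_prop) fun p hp => Or.inl (h0.trans_le hp.2.1).ne')
  refine ⟨|C|, abs_nonneg _, fun s T hs y hy => ?_⟩
  rw [norm_oscKernel s T (h0.trans_le hy.1)]
  exact (le_abs_self _).trans ((hC (s.re, y) ⟨hs, hy⟩).trans (le_abs_self _))

lemma abs_im_sub_le_norm (s : ℂ) (T y : ℝ) : |s.im - T * y| ≤ ‖s - T * y * I‖ := by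
  simpa using abs_im_le_norm (s - T * y * I)

lemma exists_norm_oscIntegral_mul_pow_le_zero (h0 : 0 < y₀) (h01 : y₀ ≤ y₁) (hb : Continuous b)
    {κ : ℝ} (hκ : 0 < κ) (A B : ℝ) (j : ℕ) :
    ∃ C, 0 ≤ C ∧ ∀ (s : ℂ) (T : ℝ), s.re ∈ Icc A B → 0 < T →
      (∀ y ∈ Icc y₀ y₁, κ * (|s.im| + T) ≤ |s.im - T * y|) →
      ‖oscIntegral y₀ y₁ s T b j‖ * (|s.im| + T) ^ j ≤ C := by
  obtain ⟨M, hM⟩ := isCompact_Icc.exists_bound_of_continuousOn (s := Icc y₀ y₁) hb.continuousOn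
  have hM0 : 0 ≤ M := (norm_nonneg _).trans (hM y₀ ⟨le_rfl, h01⟩)
  obtain ⟨D, hD0, hD⟩ := exists_norm_oscKernel_le h0 y₁ A B
  refine ⟨M * κ⁻¹ ^ j * D * |y₁ - y₀|, by positivity, fun s T hs hT hphase => ?_⟩
  have hsT : 0 < |s.im| + T := by positivity
  have hbound : ‖oscIntegral y₀ y₁ s T b j‖ ≤ M * (κ * (|s.im| + T))⁻¹ ^ j * D * |y₁ - y₀| := by
    refine intervalIntegral.norm_integral_le_of_norm_le_const fun y hy => ?_
    have hyI : y ∈ Icc y₀ y₁ := Ioc_subset_Icc_self (by rwa [uIoc_of_le h01] at hy)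
    rw [norm_mul, norm_mul, norm_pow, norm_inv]
    gcongr
    · exact hM y hyI
    · exact (hphase y hyI).trans (abs_im_sub_le_norm s T y)
    · exact hD s T hs y hyI
  calc _ ≤ M * (κ * (|s.im| + T))⁻¹ ^ j * D * |y₁ - y₀| * (|s.im| + T) ^ j := by gcongr
    _ = M * κ⁻¹ ^ j * D * |y₁ - y₀| * ((|s.im| + T)⁻¹ * (|s.im| + T)) ^ j := by
      rw [mul_inv, mul_pow, mul_pow]
      ring
    _ = _ := by rw [inv_mul_cancel₀ hsT.ne', one_pow, mul_one]

lemma norm_oscIntegral_mul_pow_le_of_by_parts (h0 : 0 < y₀) (h01 : y₀ ≤ y₁) (hb : ContDiff ℝ 1 b)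
    (hbs : tsupport b ⊆ Ioo y₀ y₁) (hT : 0 ≤ T) (hq : ∀ y ∈ Icc y₀ y₁, s - T * y * I ≠ 0)
    (j n : ℕ) :
    ‖oscIntegral y₀ y₁ s T b j‖ * (|s.im| + T) ^ (j + (n + 1)) ≤
      ‖oscIntegral y₀ y₁ s T (fun y => deriv b y * y) (j + 1)‖ * (|s.im| + T) ^ (j + 1 + n) +
        (j + 1) *
          (‖oscIntegral y₀ y₁ s T (fun y => b y * y) (j + 2)‖ * (|s.im| + T) ^ (j + 2 + n)) := by
  have hb0 : ∀ y, y ∉ Ioo y₀ y₁ → b y = 0 := fun y hy =>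
    image_eq_zero_of_notMem_tsupport fun h => hy (hbs h)
  rw [oscIntegral_by_parts h0 h01 hb (hb0 _ (by simp)) (hb0 _ (by simp)) hq j]
  set J₁ := oscIntegral y₀ y₁ s T (fun y => deriv b y * y) (j + 1)
  set J₂ := oscIntegral y₀ y₁ s T (fun y => b y * y) (j + 2)
  have hcoeff : ‖(j + 1 : ℂ) * (T * I)‖ ≤ (j + 1) * (|s.im| + T) := by
    rw [norm_mul, norm_mul, norm_I, mul_one, norm_real, Real.norm_of_nonneg hT,
      ← Nat.cast_add_one, norm_natCast, Nat.cast_add_one]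
    gcongr
    exact le_add_of_nonneg_left (abs_nonneg _)
  calc _ ≤ (‖J₁‖ + (j + 1) * (|s.im| + T) * ‖J₂‖) * (|s.im| + T) ^ (j + (n + 1)) := by
        gcongr
        exact norm_sub_le_of_le (norm_neg J₁).le (norm_mul_le_of_le hcoeff le_rfl)
    _ = _ := by ring

lemma exists_norm_oscIntegral_mul_pow_le (h0 : 0 < y₀) (h01 : y₀ ≤ y₁)
    (hb : ContDiff ℝ (⊤ : ℕ∞) b) (hbs : tsupport b ⊆ Ioo y₀ y₁) {κ : ℝ} (hκ : 0 < κ) (A B : ℝ)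
    (j n : ℕ) :
    ∃ C, 0 ≤ C ∧ ∀ (s : ℂ) (T : ℝ), s.re ∈ Icc A B → 0 < T →
      (∀ y ∈ Icc y₀ y₁, κ * (|s.im| + T) ≤ |s.im - T * y|) →
      ‖oscIntegral y₀ y₁ s T b j‖ * (|s.im| + T) ^ (j + n) ≤ C := by
  induction n generalizing b j with
  | zero => exact exists_norm_oscIntegral_mul_pow_le_zero h0 h01 hb.continuous hκ A B j
  | succ n ih =>
    have hid : ContDiff ℝ (⊤ : ℕ∞) fun y : ℝ => (y : ℂ) := ofRealCLM.contDiff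
    obtain ⟨C₁, hC₁0, hC₁⟩ := ih (b := fun y => deriv b y * y)
      ((contDiff_infty_iff_deriv.1 hb).2.mul hid)
      ((tsupport_mul_subset_left.trans tsupport_deriv_subset).trans hbs) (j + 1)
    obtain ⟨C₂, hC₂0, hC₂⟩ := ih (b := fun y => b y * y) (hb.mul hid)
      (tsupport_mul_subset_left.trans hbs) (j + 2)
    refine ⟨C₁ + (j + 1) * C₂, by positivity, fun s T hs hT hphase => ?_⟩
    have hq : ∀ y ∈ Icc y₀ y₁, s - T * y * I ≠ 0 := fun y hy => norm_pos_iff.1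
      ((by positivity : 0 < κ * (|s.im| + T)).trans_le
        ((hphase y hy).trans (abs_im_sub_le_norm s T y)))
    refine (norm_oscIntegral_mul_pow_le_of_by_parts h0 h01 (hb.of_le (by simp)) hbs hT.le hq
      j n).trans ?_
    gcongr
    exacts [hC₁ s T hs hT hphase, hC₂ s T hs hT hphase]

end NonStationaryPhase

section OscillatingTestFunction

open MeasureTheory Complex

/-- The test function `b y * exp (-i T y)`: its Mellin transform at `s` has its stationary point at
`y = im s / T`, so that it lives where `im s / T` is in the support of `b`. -/
noncomputable def oscTest (b : ℝ → ℝ) (T y : ℝ) : ℂ := b y * exp (-(T * y * I))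

variable {b : ℝ → ℝ} {w : ℝ}

lemma contDiff_oscTest (hb : ContDiff ℝ (⊤ : ℕ∞) b) (T : ℝ) :
    ContDiff ℝ (⊤ : ℕ∞) (oscTest b T) :=
  have hid : ContDiff ℝ (⊤ : ℕ∞) fun y : ℝ => (y : ℂ) := ofRealCLM.contDiff
  (hid.comp hb).mul (((contDiff_const.mul hid).mul contDiff_const).neg.cexp)

lemma norm_oscTest (b : ℝ → ℝ) (T y : ℝ) : ‖oscTest b T y‖ = |b y| := by
  simp [oscTest, norm_exp]

lemma tsupport_oscTest_subset (b : ℝ → ℝ) (T : ℝ) : tsupport (oscTest b T) ⊆ tsupport b :=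
  closure_mono fun y hy => by
    rw [Function.mem_support, ← norm_ne_zero_iff, norm_oscTest, abs_ne_zero] at hy
    exact hy

lemma hasCompactSupport_oscTest (hbs : tsupport b ⊆ Ioo w 1) (T : ℝ) :
    HasCompactSupport (oscTest b T) :=
  isCompact_Icc.of_isClosed_subset (isClosed_tsupport _)
    ((tsupport_oscTest_subset b T).trans (hbs.trans Ioo_subset_Icc_self))

lemma oscTest_eventuallyEq_zero (hw : 0 < w) (hbs : tsupport b ⊆ Ioo w 1) (T : ℝ) :
    oscTest b T =ᶠ[𝓝 0] 0 :=
  notMem_tsupport_iff_eventuallyEq.1 fun h => (hbs (tsupport_oscTest_subset b T h)).1.not_gt hw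

lemma mellinConvergent_oscTest (hw : 0 < w) (hb : ContDiff ℝ (⊤ : ℕ∞) b)
    (hbs : tsupport b ⊆ Ioo w 1) (T : ℝ) (s : ℂ) : MellinConvergent (oscTest b T) s :=
  mellinConvergent_of_hasCompactSupport (contDiff_oscTest hb T).continuous
    (hasCompactSupport_oscTest hbs T) (oscTest_eventuallyEq_zero hw hbs T) s

lemma mellin_oscTest {y₀ y₁ : ℝ} (h0 : 0 < y₀) (h01 : y₀ ≤ y₁) (hbs : tsupport b ⊆ Ioo y₀ y₁)
    (T : ℝ) (s : ℂ) :
    mellin (oscTest b T) s = oscIntegral y₀ y₁ s T (fun y => b y) 0 := by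
  rw [mellin, oscIntegral, intervalIntegral.integral_of_le h01,
    setIntegral_eq_of_subset_of_forall_sdiff_eq_zero measurableSet_Ioi
      (fun y hy => h0.trans hy.1 : Ioc y₀ y₁ ⊆ Ioi 0) fun y hy => ?_]
  · refine setIntegral_congr_fun measurableSet_Ioc fun y _ => ?_
    simp only [oscTest, oscKernel, smul_eq_mul, pow_zero, mul_one]
    ring
  · have hby : b y = 0 :=
      image_eq_zero_of_notMem_tsupport fun h => hy.2 (Ioo_subset_Ioc_self (hbs h))
    simp [oscTest, hby]

lemma le_abs_sub_of_notMem_window {y₀ y₁ y t T : ℝ} (hw : 0 < w) (hwy : w < y₀) (hy1 : y₁ < 1)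
    (hT : 0 < T) (ht : t ∉ Icc (w * T) T) (hy : y ∈ Icc y₀ y₁) :
    min ((1 - y₁) / 2) ((y₀ - w) / 2) * (|t| + T) ≤ |t - T * y| := by
  have hyT : T * y ∈ Icc (T * y₀) (T * y₁) := by
    constructor <;> gcongr
    exacts [hy.1, hy.2]
  rcases lt_or_ge t (w * T) with hlt | hge
  · have htT : |t| - T ≤ 0 ∨ t ≤ 0 ∧ |t| = -t := by
      rcases le_total 0 t with h | h
      · left
        rw [abs_of_nonneg h]
        nlinarith [hy.1, hy.2]
      · exact Or.inr ⟨h, abs_of_nonpos h⟩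
    calc _ ≤ (y₀ - w) / 2 * (|t| + T) := by gcongr; exact min_le_right _ _
      _ ≤ T * y - t := by
        rcases htT with h | ⟨h, habs⟩
        · nlinarith [hyT.1]
        · rw [habs]
          nlinarith [hyT.1, hy.1, hy.2]
      _ ≤ _ := by rw [abs_sub_comm]; exact le_abs_self _
  · have hTt : T < t := not_le.1 fun h => ht ⟨hge, h⟩
    calc _ ≤ (1 - y₁) / 2 * (|t| + T) := by gcongr; exact min_le_left _ _
      _ ≤ t - T * y := by
        rw [abs_of_pos (hT.trans hTt)]
        nlinarith [hyT.2, hy.1, hy.2]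
      _ ≤ _ := le_abs_self _

lemma exists_subset_Ioo_of_isCompact {K : Set ℝ} {a c : ℝ} (hK : IsCompact K) (hac : a < c)
    (hKs : K ⊆ Ioo a c) : ∃ y₀ y₁, a < y₀ ∧ y₀ ≤ y₁ ∧ y₁ < c ∧ K ⊆ Ioo y₀ y₁ := by
  obtain ⟨m, hac_m, hm⟩ := exists_between hac
  have hsub : insert m K ⊆ Ioo a c := insert_subset ⟨hac_m, hm⟩ hKs
  obtain ⟨p, hp, hp_le⟩ := (hK.insert m).exists_isLeast (insert_nonempty _ _)
  obtain ⟨q, hq, hq_le⟩ := (hK.insert m).exists_isGreatest (insert_nonempty _ _)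
  obtain ⟨y₀, hay₀, hy₀⟩ := exists_between (hsub hp).1
  obtain ⟨y₁, hy₁, hy₁c⟩ := exists_between (hsub hq).2
  exact ⟨y₀, y₁, hay₀, (hy₀.le.trans (hp_le hq)).trans hy₁.le, hy₁c, fun y hy =>
    ⟨hy₀.trans_le (hp_le (mem_insert_of_mem m hy)), (hq_le (mem_insert_of_mem m hy)).trans_lt hy₁⟩⟩

lemma windowConcentrated_mellin_oscTest (hw : 0 < w) (hw1 : w < 1) (hb : ContDiff ℝ (⊤ : ℕ∞) b)
    (hbs : tsupport b ⊆ Ioo w 1) : WindowConcentrated w fun T => mellin (oscTest b T) := by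
  obtain ⟨y₀, y₁, hwy, h01, hy1, hbs'⟩ := exists_subset_Ioo_of_isCompact
    (isCompact_Icc.of_isClosed_subset (isClosed_tsupport b) (hbs.trans Ioo_subset_Icc_self))
    hw1 hbs
  have h0 : 0 < y₀ := hw.trans hwy
  have hbc : ContDiff ℝ (⊤ : ℕ∞) fun y => (b y : ℂ) := ofRealCLM.contDiff.comp hb
  refine ⟨fun T => differentiable_mellin_of_hasCompactSupport (contDiff_oscTest hb T).continuous
    (hasCompactSupport_oscTest hbs T) (oscTest_eventuallyEq_zero hw hbs T), fun A B => ?_,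
    fun A B n => ?_⟩
  · obtain ⟨M, hM⟩ := isCompact_Icc.exists_bound_of_continuousOn (s := Icc y₀ y₁)
      hb.continuous.continuousOn
    obtain ⟨D, hD, hker⟩ := exists_norm_oscKernel_le h0 y₁ A B
    refine ⟨|M| * D * |y₁ - y₀|, by positivity, fun T _ s hs => ?_⟩
    rw [mellin_oscTest h0 h01 hbs']
    refine intervalIntegral.norm_integral_le_of_norm_le_const fun y hy => ?_
    have hyI : y ∈ Icc y₀ y₁ := Ioc_subset_Icc_self (by rwa [uIoc_of_le h01] at hy)
    rw [pow_zero, mul_one, norm_mul, norm_real]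
    gcongr
    exacts [(hM y hyI).trans (le_abs_self M), hker s T hs y hyI]
  · obtain ⟨C, hC, hosc⟩ := exists_norm_oscIntegral_mul_pow_le h0 h01 hbc
      ((tsupport_comp_subset ofReal_zero b).trans hbs')
      (κ := min ((1 - y₁) / 2) ((y₀ - w) / 2)) (lt_min (by linarith) (by linarith)) A B 0 n
    refine ⟨C, hC, fun T hT s hs him => ?_⟩
    have hT0 : 0 < T := zero_lt_one.trans_le hT
    rw [mellin_oscTest h0 h01 hbs']
    simpa only [zero_add] using hosc s T hs hT0 fun y hy =>
      le_abs_sub_of_notMem_window hw hwy hy1 hT0 him hy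

end OscillatingTestFunction

section DilateSum

open MeasureTheory Complex

/-- The superposition `∑ m ≤ N, c m * f (m y)` of dilates of `f`. -/
def dilateSum {R : Type*} [NonUnitalNonAssocSemiring R] (N : ℕ) (c : ℕ → R) (f : ℝ → R) (y : ℝ) :
    R :=
  ∑ m ∈ Finset.Icc 1 N, c m * f (m * y)

/-- The Dirichlet polynomial `∑ m ≤ N, c m * m ^ (-s)`, by which the Mellin transform is multiplied
when `f` is replaced with `dilateSum N c f`. -/
noncomputable def dirichletPolynomial (N : ℕ) (c : ℕ → ℂ) (s : ℂ) : ℂ :=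
  ∑ m ∈ Finset.Icc 1 N, c m * (m : ℂ) ^ (-s)

variable {N : ℕ} {c : ℕ → ℂ} {f : ℝ → ℂ} {w σ : ℝ}

lemma natCast_pos_of_mem_Icc {m : ℕ} (hm : m ∈ Finset.Icc 1 N) : (0 : ℝ) < m :=
  Nat.cast_pos.2 (Finset.mem_Icc.1 hm).1

lemma differentiable_dirichletPolynomial (N : ℕ) (c : ℕ → ℂ) :
    Differentiable ℂ (dirichletPolynomial N c) :=
  Differentiable.fun_sum fun m hm => (differentiable_neg.const_cpow
    (Or.inl (Nat.cast_ne_zero.2 (Nat.one_le_iff_ne_zero.1 (Finset.mem_Icc.1 hm).1)))).const_mul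
      (c m)

lemma norm_dirichletPolynomial_le (c : ℕ → ℂ) {A : ℝ} {s : ℂ} (hs : A ≤ s.re) :
    ‖dirichletPolynomial N c s‖ ≤ ∑ m ∈ Finset.Icc 1 N, ‖c m‖ * (m : ℝ) ^ (-A) := by
  refine norm_sum_le_of_le _ fun m hm => ?_
  have hm1 : 1 ≤ m := (Finset.mem_Icc.1 hm).1
  rw [norm_mul, norm_natCast_cpow_of_pos hm1]
  gcongr
  · exact_mod_cast hm1
  · simpa using hs

lemma contDiff_dilateSum (hf : ContDiff ℝ (⊤ : ℕ∞) f) (N : ℕ) (c : ℕ → ℂ) :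
    ContDiff ℝ (⊤ : ℕ∞) (dilateSum N c f) :=
  ContDiff.sum fun _ _ => contDiff_const.mul (hf.comp (contDiff_const.mul contDiff_id))

lemma hasCompactSupport_dilateSum (hf : HasCompactSupport f) (N : ℕ) (c : ℕ → ℂ) :
    HasCompactSupport (dilateSum N c f) := by
  have hdilate : ∀ m ∈ Finset.Icc 1 N, (fun y : ℝ => f (m * y)) =ᶠ[coclosedCompact ℝ] 0 :=
    fun m hm => hasCompactSupport_iff_eventuallyEq.1
      (by simpa only [smul_eq_mul] using hf.comp_smul (natCast_pos_of_mem_Icc hm).ne')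
  rw [hasCompactSupport_iff_eventuallyEq]
  filter_upwards [(Finset.eventually_all _).2 hdilate] with y hy
  exact Finset.sum_eq_zero fun m hm => by rw [hy m hm, Pi.zero_apply, mul_zero]

lemma dilateSum_eventuallyEq_zero (h0 : f =ᶠ[𝓝 0] 0) (N : ℕ) (c : ℕ → ℂ) :
    dilateSum N c f =ᶠ[𝓝 0] 0 := by
  have hdilate : ∀ m ∈ Finset.Icc 1 N, (fun y : ℝ => f (m * y)) =ᶠ[𝓝 0] 0 := fun m _ =>
    (Continuous.tendsto' (by fun_prop) 0 0 (mul_zero (m : ℝ))).eventually h0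
  filter_upwards [(Finset.eventually_all _).2 hdilate] with y hy
  exact Finset.sum_eq_zero fun m hm => by rw [hy m hm, Pi.zero_apply, mul_zero]

lemma mellin_dilateSum {s : ℂ} (hf : MellinConvergent f s) (N : ℕ) (c : ℕ → ℂ) :
    mellin (dilateSum N c f) s = dirichletPolynomial N c s * mellin f s := by
  have hconv : ∀ m ∈ Finset.Icc 1 N, MellinConvergent (fun y => c m * f (m * y)) s := fun m hm =>
    ((MellinConvergent.comp_mul_left (natCast_pos_of_mem_Icc hm)).2 hf).const_smul (c m)
  have hsum : mellin (dilateSum N c f) s =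
      ∑ m ∈ Finset.Icc 1 N, mellin (fun y => c m • f (m * y)) s := by
    simp only [mellin, dilateSum, Finset.smul_sum]
    exact integral_finsetSum _ hconv
  rw [hsum, dirichletPolynomial, Finset.sum_mul]
  refine Finset.sum_congr rfl fun m hm => ?_
  rw [mellin_const_smul (fun y => f (m * y)), mellin_comp_mul_left _ _ (natCast_pos_of_mem_Icc hm),
    smul_eq_mul, smul_eq_mul, ofReal_natCast, mul_assoc]

lemma eq_of_natCast_mul_mem_Ioo (hN : N ≤ w * (N + 1)) {m n : ℕ} (hm : m ∈ Finset.Icc 1 N)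
    (hn : n ∈ Finset.Icc 1 N) {y : ℝ} (hmy : m * y ∈ Ioo w 1) (hny : n * y ∈ Ioo w 1) : m = n := by
  have hN0 : (0 : ℝ) < N :=
    Nat.cast_pos.2 ((Finset.mem_Icc.1 hm).1.trans (Finset.mem_Icc.1 hm).2)
  have hw : 0 < w := pos_of_mul_pos_left (hN0.trans_le hN) (by positivity)
  have h_not_lt : ∀ p ∈ Finset.Icc 1 N, ∀ q ∈ Finset.Icc 1 N, p * y ∈ Ioo w 1 →
      q * y ∈ Ioo w 1 → ¬ p < q := fun p hp q hq hpy hqy hpq => by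
    have hpq' : (p : ℝ) + 1 ≤ q := by exact_mod_cast hpq
    have hqN : (q : ℝ) ≤ N := by exact_mod_cast (Finset.mem_Icc.1 hq).2
    have hy : 0 < y := pos_of_mul_pos_right (hw.trans hpy.1) (natCast_pos_of_mem_Icc hp).le
    have hstep : (p + 1) * y < 1 := lt_of_le_of_lt (by gcongr) hqy.2
    nlinarith [hpy.1, natCast_pos_of_mem_Icc hp]
  exact le_antisymm (not_lt.1 (h_not_lt _ hn _ hm hny hmy)) (not_lt.1 (h_not_lt _ hm _ hn hmy hny))

lemma norm_dilateSum_sq (hN : N ≤ w * (N + 1)) (hf : tsupport f ⊆ Ioo w 1) (c : ℕ → ℂ) (y : ℝ) :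
    ‖dilateSum N c f y‖ ^ 2 = ∑ m ∈ Finset.Icc 1 N, ‖c m‖ ^ 2 * ‖f (m * y)‖ ^ 2 := by
  have hf0 : ∀ {u : ℝ}, u ∉ Ioo w 1 → f u = 0 := fun hu =>
    image_eq_zero_of_notMem_tsupport fun h => hu (hf h)
  by_cases hex : ∃ m ∈ Finset.Icc 1 N, (m : ℝ) * y ∈ Ioo w 1
  · obtain ⟨m, hm, hmy⟩ := hex
    have hothers : ∀ n ∈ Finset.Icc 1 N, n ≠ m → f (n * y) = 0 := fun n hn hnm =>
      hf0 fun hny => hnm (eq_of_natCast_mul_mem_Ioo hN hn hm hny hmy)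
    rw [dilateSum, Finset.sum_eq_single_of_mem m hm fun n hn hnm => by
        rw [hothers n hn hnm, mul_zero],
      Finset.sum_eq_single_of_mem m hm fun n hn hnm => by simp [hothers n hn hnm],
      norm_mul, mul_pow]
  · push Not at hex
    rw [dilateSum, Finset.sum_eq_zero fun n hn => by rw [hf0 (hex n hn), mul_zero],
      Finset.sum_eq_zero fun n hn => by simp [hf0 (hex n hn)]]
    simp

lemma integrableOn_rpow_mul_norm_sq (hf : Continuous f) (hc : HasCompactSupport f)
    (h0 : f =ᶠ[𝓝 0] 0) (σ : ℝ) :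
    IntegrableOn (fun y : ℝ => y ^ (2 * σ - 1) * ‖f y‖ ^ 2) (Ioi 0) := by
  have hconv := mellinConvergent_of_hasCompactSupport (f := fun y => ((‖f y‖ ^ 2 : ℝ) : ℂ))
    (by fun_prop) (hc.mono fun y hy h => hy (by simp [h]))
    (h0.mono fun y hy => by simp [hy]) ((2 * σ : ℝ) : ℂ)
  refine IntegrableOn.congr_fun (Integrable.norm hconv) (fun y hy => ?_) measurableSet_Ioi
  simp [norm_cpow_eq_rpow_re_of_pos (show (0 : ℝ) < y from hy)]

lemma setIntegral_rpow_mul_comp_mul_left (g : ℝ → ℝ) {a : ℝ} (ha : 0 < a) (p : ℝ) :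
    ∫ y in Ioi (0 : ℝ), y ^ (p - 1) * g (a * y) =
      a ^ (-p) * ∫ y in Ioi (0 : ℝ), y ^ (p - 1) * g y := by
  have hscale := integral_comp_mul_left_Ioi (fun y : ℝ => y ^ (p - 1) * g y) 0 ha
  have hfactor : ∫ y in Ioi (0 : ℝ), (a * y) ^ (p - 1) * g (a * y) =
      a ^ (p - 1) * ∫ y in Ioi (0 : ℝ), y ^ (p - 1) * g (a * y) := by
    rw [← integral_const_mul]
    refine setIntegral_congr_fun measurableSet_Ioi fun y hy => ?_
    rw [Real.mul_rpow ha.le (le_of_lt hy), mul_assoc]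
  rw [mul_zero, smul_eq_mul, hfactor] at hscale
  rw [← mul_right_inj' (Real.rpow_pos_of_pos ha (p - 1)).ne', hscale, ← mul_assoc,
    ← Real.rpow_add ha, show p - 1 + -p = -1 by ring, Real.rpow_neg_one]

lemma integral_norm_mellin_dilateSum_sq (hN : N ≤ w * (N + 1)) (hw : 0 < w)
    (hf : ContDiff ℝ (⊤ : ℕ∞) f) (hfs : tsupport f ⊆ Ioo w 1) (c : ℕ → ℂ) (σ : ℝ) :
    ∫ t : ℝ, ‖mellin (dilateSum N c f) (σ + t * I)‖ ^ 2 =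
      2 * Real.pi * ((∑ m ∈ Finset.Icc 1 N, ‖c m‖ ^ 2 * (m : ℝ) ^ (-(2 * σ))) *
        ∫ y in Ioi (0 : ℝ), y ^ (2 * σ - 1) * ‖f y‖ ^ 2) := by
  have hfc : HasCompactSupport f :=
    isCompact_Icc.of_isClosed_subset (isClosed_tsupport f) (hfs.trans Ioo_subset_Icc_self)
  have hf0 : f =ᶠ[𝓝 0] 0 :=
    notMem_tsupport_iff_eventuallyEq.1 fun h => (hfs h).1.not_gt hw
  have hint : ∀ m ∈ Finset.Icc 1 N, IntegrableOn
      (fun y : ℝ => ‖c m‖ ^ 2 * (y ^ (2 * σ - 1) * ‖f (m * y)‖ ^ 2)) (Ioi 0) := fun m hm => by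
    have hm0 := natCast_pos_of_mem_Icc hm
    refine (integrableOn_rpow_mul_norm_sq (f := fun y => f (m * y))
      (hf.continuous.comp (by fun_prop))
      (by simpa only [smul_eq_mul] using hfc.comp_smul hm0.ne') ?_ σ).const_mul _
    exact (Continuous.tendsto' (by fun_prop) 0 0 (mul_zero (m : ℝ))).eventually hf0
  rw [integral_norm_mellin_sq (contDiff_dilateSum hf N c) (hasCompactSupport_dilateSum hfc N c)
    (dilateSum_eventuallyEq_zero hf0 N c)]
  congr 1
  simp only [norm_dilateSum_sq hN hfs, Finset.mul_sum, mul_left_comm _ (‖c _‖ ^ 2)]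
  rw [integral_finsetSum _ hint, Finset.sum_mul]
  refine Finset.sum_congr rfl fun m hm => ?_
  rw [integral_const_mul, setIntegral_rpow_mul_comp_mul_left (fun y => ‖f y‖ ^ 2)
    (natCast_pos_of_mem_Icc hm), mul_assoc]

end DilateSum

section ZetaDirichletSeries

open Complex

lemma iterate_logMul_one_apply (ℓ n : ℕ) :
    (LSeries.logMul^[ℓ] (1 : ℕ → ℂ)) n = (Real.log n : ℂ) ^ ℓ := by
  induction ℓ with
  | zero => simp
  | succ ℓ ih =>
    rw [Function.iterate_succ_apply', LSeries.logMul, ih, pow_succ', natCast_log]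

lemma LSeriesSummable_iterate_logMul_one (ℓ : ℕ) {s : ℂ} (hs : 1 < s.re) :
    LSeriesSummable (LSeries.logMul^[ℓ] 1) s := by
  refine LSeriesSummable_of_abscissaOfAbsConv_lt_re ?_
  rw [LSeries.absicssaOfAbsConv_logPowMul, LSeries.abscissaOfAbsConv_one]
  exact_mod_cast hs

lemma iteratedDeriv_riemannZeta_eq_LSeries (ℓ : ℕ) {s : ℂ} (hs : 1 < s.re) :
    iteratedDeriv ℓ riemannZeta s = (-1) ^ ℓ * LSeries (LSeries.logMul^[ℓ] 1) s := by
  have hζ : riemannZeta =ᶠ[𝓝 s] LSeries 1 := by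
    filter_upwards [(isOpen_lt continuous_const continuous_re).mem_nhds hs] with z hz
    exact (LSeries_one_eq_riemannZeta hz).symm
  rw [hζ.iteratedDeriv_eq, LSeries_iteratedDeriv ℓ]
  rw [LSeries.abscissaOfAbsConv_one]
  exact_mod_cast hs

lemma mellinInv_const_mul (σ : ℝ) (c : ℂ) (F : ℂ → ℂ) (x : ℝ) :
    mellinInv σ (fun s => c * F s) x = c * mellinInv σ F x := by
  simp only [mellinInv, smul_eq_mul, mul_left_comm _ c, MeasureTheory.integral_const_mul,
    mul_smul_comm]

lemma hasSum_log_pow_mul_eq_mellinInv (ℓ : ℕ) {f : ℝ → ℂ} {b x : ℝ} (hb : 1 < b)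
    (hf : Continuous f) (hf0 : f 0 = 0) (hmellin : MellinConvergent f b)
    (hvert : VerticalIntegrable (mellin f) b) (hx : 0 < x) :
    HasSum (fun n : ℕ => (Real.log n : ℂ) ^ ℓ * f (n * x))
      ((-1) ^ ℓ * mellinInv b (fun s => iteratedDeriv ℓ riemannZeta s * mellin f s) x) := by
  have hline : mellinInv b (fun s => iteratedDeriv ℓ riemannZeta s * mellin f s) x =
      mellinInv b (fun s => (-1) ^ ℓ * (LSeries (LSeries.logMul^[ℓ] 1) s * mellin f s)) x := by
    simp only [mellinInv]
    congr 3 with t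
    rw [iteratedDeriv_riemannZeta_eq_LSeries ℓ (by simpa using hb), mul_assoc]
  rw [hline, mellinInv_const_mul, ← mul_assoc, ← mul_pow, neg_one_mul, neg_neg, one_pow, one_mul]
  simpa only [iterate_logMul_one_apply] using
    hasSum_mellinInv_LSeries_mul_mellin (LSeriesSummable_iterate_logMul_one ℓ (by simpa using hb))
      hf hf0 hmellin hvert hx

end ZetaDirichletSeries

section ResonanceInequality

open MeasureTheory Complex

variable {N : ℕ} {b : ℝ → ℝ} {w σ : ℝ}

lemma windowConcentrated_mellin_dilateSum_oscTest (hw : 0 < w) (hw1 : w < 1)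
    (hb : ContDiff ℝ (⊤ : ℕ∞) b) (hbs : tsupport b ⊆ Ioo w 1) (N : ℕ) (c : ℕ → ℂ) :
    WindowConcentrated w fun T => mellin (dilateSum N c (oscTest b T)) := by
  have hmul := (windowConcentrated_mellin_oscTest hw hw1 hb hbs).mul
    (differentiable_dirichletPolynomial N c) fun A _ =>
      ⟨∑ m ∈ Finset.Icc 1 N, ‖c m‖ * (m : ℝ) ^ (-A), by positivity,
        fun s hs => norm_dirichletPolynomial_le c hs.1⟩
  convert hmul using 3 with T s
  exact mellin_dilateSum (mellinConvergent_oscTest hw hb hbs T s) N c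

lemma integral_norm_mellin_dilateSum_oscTest_sq (hw : 0 < w) (hb : ContDiff ℝ (⊤ : ℕ∞) b)
    (hbs : tsupport b ⊆ Ioo w 1) (hN : N ≤ w * (N + 1)) (c : ℕ → ℝ) (σ T : ℝ) :
    ∫ t : ℝ, ‖mellin (dilateSum N (fun m => (c m : ℂ)) (oscTest b T)) (σ + t * I)‖ ^ 2 =
      2 * Real.pi * ((∑ m ∈ Finset.Icc 1 N, c m ^ 2 * (m : ℝ) ^ (-(2 * σ))) *
        ∫ y in Ioi (0 : ℝ), y ^ (2 * σ - 1) * b y ^ 2) := by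
  simpa only [norm_oscTest, norm_real, Real.norm_eq_abs, sq_abs] using
    integral_norm_mellin_dilateSum_sq hN hw (contDiff_oscTest hb T)
      ((tsupport_oscTest_subset b T).trans hbs) (fun m => (c m : ℂ)) σ

-- The frequency `2 π X` makes the oscillating factor equal to `1` on the lattice `X⁻¹ ℤ`.
lemma dilateSum_oscTest_natCast_mul_inv {X : ℝ} (hX : X ≠ 0) (N : ℕ) (c : ℕ → ℝ) (b : ℝ → ℝ)
    (n : ℕ) :
    dilateSum N (fun m => (c m : ℂ)) (oscTest b (2 * Real.pi * X)) (n * X⁻¹) =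
      (dilateSum N c b (n * X⁻¹) : ℝ) := by
  have hXc : (X : ℂ) ≠ 0 := ofReal_ne_zero.2 hX
  simp only [dilateSum, oscTest, ofReal_sum, ofReal_mul]
  refine Finset.sum_congr rfl fun m _ => ?_
  have hphase : -(2 * Real.pi * X * (m * (n * (X : ℂ)⁻¹)) * I) =
      -((m * n : ℕ) * (2 * Real.pi * I)) := by
    push_cast
    field_simp
  push_cast
  rw [hphase, exp_neg, exp_nat_mul_two_pi_mul_I, inv_one, mul_one]

lemma hasSum_log_pow_mul_dilateSum (hw : 0 < w) (hw1 : w < 1) (hb : ContDiff ℝ (⊤ : ℕ∞) b)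
    (hbs : tsupport b ⊆ Ioo w 1) (c : ℕ → ℝ) (ℓ : ℕ) {σ X : ℝ} (hσ : 1 < σ) (hX : 1 ≤ X) :
    HasSum (fun n : ℕ => ((Real.log n ^ ℓ * dilateSum N c b (n * X⁻¹) : ℝ) : ℂ))
      ((-1) ^ ℓ * mellinInv σ (fun s => iteratedDeriv ℓ riemannZeta s *
        mellin (dilateSum N (fun m => (c m : ℂ)) (oscTest b (2 * Real.pi * X))) s) X⁻¹) := by
  have hX0 : 0 < X := zero_lt_one.trans_le hX
  have hT : 1 ≤ 2 * Real.pi * X :=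
    one_le_mul_of_one_le_of_one_le (by linarith [Real.pi_gt_three]) hX
  set f := dilateSum N (fun m => (c m : ℂ)) (oscTest b (2 * Real.pi * X)) with hf
  have hsmooth : ContDiff ℝ (⊤ : ℕ∞) f := contDiff_dilateSum (contDiff_oscTest hb _) N _
  have hzero : f =ᶠ[𝓝 0] 0 := dilateSum_eventuallyEq_zero (oscTest_eventuallyEq_zero hw hbs _) N _
  have hsum := hasSum_log_pow_mul_eq_mellinInv ℓ hσ hsmooth.continuous hzero.self_of_nhds
    (mellinConvergent_of_hasCompactSupport hsmooth.continuous
      (hasCompactSupport_dilateSum (hasCompactSupport_oscTest hbs _) N _) hzero σ)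
    ((windowConcentrated_mellin_dilateSum_oscTest hw hw1 hb hbs N _).verticalIntegrable hT σ)
    (inv_pos.2 hX0)
  simpa only [hf, dilateSum_oscTest_natCast_mul_inv hX0.ne', ofReal_mul, ofReal_pow] using hsum

lemma exists_abs_tsum_log_pow_mul_dilateSum_le (hw : 0 < w) (hw1 : w < 1)
    (hb : ContDiff ℝ (⊤ : ℕ∞) b) (hbs : tsupport b ⊆ Ioo w 1) (hN : N ≤ w * (N + 1))
    (c : ℕ → ℝ) (ℓ : ℕ) (hσ : σ < 1) :
    ∃ C : ℝ, 0 ≤ C ∧ ∀ X : ℝ, 1 ≤ X → ∀ M : ℝ, 0 ≤ M →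
      (∀ t ∈ Icc (w * (2 * Real.pi * X)) (2 * Real.pi * X),
        ‖iteratedDeriv ℓ riemannZeta (σ + t * I)‖ ≤ M) →
      |∑' n : ℕ, Real.log n ^ ℓ * dilateSum N c b (n * X⁻¹)| ≤
        M * X ^ (σ + 1 / 2) * √((1 - w) *
          ((∑ m ∈ Finset.Icc 1 N, c m ^ 2 * (m : ℝ) ^ (-(2 * σ))) *
            ∫ y in Ioi (0 : ℝ), y ^ (2 * σ - 1) * b y ^ 2)) + C * X ^ (3 / 4 : ℝ) := by
  have henergy := integral_norm_mellin_dilateSum_oscTest_sq hw hb hbs hN c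
  obtain ⟨C, hC, hshift⟩ := (windowConcentrated_mellin_dilateSum_oscTest hw hw1 hb hbs N
    fun m => (c m : ℂ)).exists_norm_mellinInv_iteratedDeriv_riemannZeta_le hw hw1.le ℓ
    (b := (5 / 4 : ℝ)) hσ (by norm_num) (fun T _ => (henergy σ T).le)
    fun T _ => (henergy (5 / 4 : ℝ) T).le
  refine ⟨C, hC, fun X hX M hM hMζ => ?_⟩
  have hX0 : 0 < X := zero_lt_one.trans_le hX
  have hπ : 1 ≤ 2 * Real.pi := by linarith [Real.pi_gt_three]
  have hbound := hshift _ (one_le_mul_of_one_le_of_one_le hπ hX) M hM hMζ X⁻¹ (inv_pos.2 hX0)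
    (inv_le_one_of_one_le₀ hX)
  have hsum := hasSum_log_pow_mul_dilateSum (N := N) hw hw1 hb hbs c ℓ
    (σ := (5 / 4 : ℝ)) (by norm_num) hX
  rw [← Real.norm_eq_abs, ← norm_real, ofReal_tsum, hsum.tsum_eq, norm_mul, norm_pow, norm_neg,
    norm_one, one_pow, one_mul]
  refine hbound.trans (add_le_add (le_of_eq ?_) ?_)
  · rw [Real.inv_rpow hX0.le, Real.rpow_neg hX0.le, inv_inv, ← Real.sqrt_mul
      (mul_nonneg (sub_nonneg.2 hw1.le) (by positivity)), Real.rpow_add hX0, ← Real.sqrt_eq_rpow,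
      show ∀ E : ℝ, (1 - w) * (2 * Real.pi * X) * (2 * Real.pi * E) =
        (2 * Real.pi) ^ 2 * (X * ((1 - w) * E)) from fun E => by ring,
      Real.sqrt_mul (by positivity), Real.sqrt_sq (by positivity), Real.sqrt_mul hX0.le]
    field_simp
  · rw [Real.inv_rpow hX0.le, Real.rpow_neg hX0.le, inv_inv, show (5 / 4 : ℝ) = 3 / 4 + 1 / 2 by
      norm_num, Real.rpow_add hX0, ← Real.sqrt_eq_rpow, mul_comm C, mul_assoc]
    gcongr
    rw [mul_div_assoc', div_le_iff₀ (by positivity), mul_comm]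
    gcongr
    exact le_mul_of_one_le_left hX0.le hπ

end ResonanceInequality

section DilateSumLowerBound

variable {b : ℝ → ℝ} {z₀ z₁ : ℝ}

lemma sub_sub_one_le_card_Icc_ceil_floor {α β : ℝ} (hα : 0 ≤ α) :
    β - α - 1 ≤ (Finset.Icc ⌈α⌉₊ ⌊β⌋₊).card := by
  have hsub : ((⌊β⌋₊ + 1 : ℕ) : ℝ) - (⌈α⌉₊ : ℕ) ≤ ((⌊β⌋₊ + 1 - ⌈α⌉₊ : ℕ) : ℝ) := by
    rw [sub_le_iff_le_add]
    exact_mod_cast le_tsub_add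
  rw [Nat.card_Icc]
  push_cast at hsub
  linarith [Nat.lt_floor_add_one β, Nat.ceil_lt_add_one hα]

lemma summable_mul_comp_natCast_mul (a : ℕ → ℝ) (hb : ∀ y, 1 ≤ y → b y = 0) {x : ℝ} (hx : 0 < x) :
    Summable fun n : ℕ => a n * b (n * x) := by
  refine summable_of_hasFiniteSupport ((finite_Iic ⌊1 / x⌋₊).subset fun n hn => ?_)
  have hnx : n * x < 1 := not_le.1 fun h => hn (by simp only [hb _ h, mul_zero])
  exact Nat.le_floor ((le_div_iff₀ hx).2 hnx.le)

lemma log_pow_mul_le_tsum_log_pow_mul (hb0 : ∀ y, 0 ≤ b y) (hb : ∀ y, 1 ≤ y → b y = 0)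
    (hb1 : ∀ y ∈ Icc z₀ z₁, b y = 1) (ℓ : ℕ) {x : ℝ} (hx : 0 < x) (hxz : x ≤ z₀) :
    Real.log (z₀ / x) ^ ℓ * ((z₁ - z₀) / x - 1) ≤ ∑' n : ℕ, Real.log n ^ ℓ * b (n * x) := by
  have hz₀ : 0 < z₀ := hx.trans_le hxz
  have hlog : 0 ≤ Real.log (z₀ / x) := Real.log_nonneg ((one_le_div hx).2 hxz)
  set I := Finset.Icc ⌈z₀ / x⌉₊ ⌊z₁ / x⌋₊
  have hterm : ∀ n ∈ I, Real.log (z₀ / x) ^ ℓ ≤ Real.log n ^ ℓ * b (n * x) := fun n hn => by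
    have hle : z₀ / x ≤ n := Nat.ceil_le.1 (Finset.mem_Icc.1 hn).1
    have hn0 : n ≠ 0 := by
      rintro rfl
      exact (div_pos hz₀ hx).not_ge (by simpa using hle)
    have hge : (n : ℝ) ≤ z₁ / x := (Nat.le_floor_iff' hn0).1 (Finset.mem_Icc.1 hn).2
    rw [hb1 _ ⟨(div_le_iff₀ hx).1 hle, (le_div_iff₀ hx).1 hge⟩, mul_one]
    gcongr
  calc Real.log (z₀ / x) ^ ℓ * ((z₁ - z₀) / x - 1)
      ≤ Real.log (z₀ / x) ^ ℓ * I.card := by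
        gcongr
        rw [sub_div]
        exact sub_sub_one_le_card_Icc_ceil_floor (by positivity)
    _ = ∑ _n ∈ I, Real.log (z₀ / x) ^ ℓ := by rw [Finset.sum_const, nsmul_eq_mul, mul_comm]
    _ ≤ ∑ n ∈ I, Real.log n ^ ℓ * b (n * x) := Finset.sum_le_sum hterm
    _ ≤ ∑' n : ℕ, Real.log n ^ ℓ * b (n * x) :=
        (summable_mul_comp_natCast_mul _ hb hx).sum_le_tsum I fun n _ =>
          mul_nonneg (pow_nonneg (Real.log_natCast_nonneg n) ℓ) (hb0 _)

lemma tsum_mul_dilateSum (a : ℕ → ℝ) (N : ℕ) (c : ℕ → ℝ) (hb : ∀ y, 1 ≤ y → b y = 0) {x : ℝ}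
    (hx : 0 < x) :
    ∑' n : ℕ, a n * dilateSum N c b (n * x) =
      ∑ m ∈ Finset.Icc 1 N, c m * ∑' n : ℕ, a n * b (n * (m * x)) := by
  have hsummable : ∀ m ∈ Finset.Icc 1 N, Summable fun n : ℕ => c m * (a n * b (n * (m * x))) :=
    fun m hm => (summable_mul_comp_natCast_mul a hb
      (mul_pos (natCast_pos_of_mem_Icc hm) hx)).mul_left (c m)
  simp only [← tsum_mul_left]
  rw [← Summable.tsum_finsetSum hsummable]
  refine tsum_congr fun n => ?_
  rw [dilateSum, Finset.mul_sum]
  exact Finset.sum_congr rfl fun m _ => by rw [mul_left_comm (m : ℝ), mul_left_comm]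

lemma tendsto_log_mul_div_log_mul {p a : ℝ} (hp : 0 < p) (ha : 0 < a) :
    Tendsto (fun X : ℝ => Real.log (p * X) / Real.log (a * X)) atTop (𝓝 1) := by
  have hlog : Tendsto (fun X : ℝ => Real.log (a * X)) atTop atTop :=
    Real.tendsto_log_atTop.comp (tendsto_id.const_mul_atTop ha)
  have hlim : Tendsto (fun X : ℝ => 1 + Real.log (p / a) / Real.log (a * X)) atTop (𝓝 1) := by
    simpa only [add_zero] using (hlog.const_div_atTop (Real.log (p / a))).const_add 1
  refine hlim.congr' ?_
  filter_upwards [eventually_gt_atTop 0, hlog.eventually_gt_atTop 0] with X hX hlogX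
  rw [one_add_div hlogX.ne', Real.log_div hp.ne' ha.ne', Real.log_mul hp.ne' hX.ne',
    Real.log_mul ha.ne' hX.ne']
  ring

lemma tendsto_log_pow_mul_div (ℓ : ℕ) (hz₀ : 0 < z₀) (z₁ : ℝ) {a : ℝ} (ha : 0 < a) {m : ℝ}
    (hm : 0 < m) :
    Tendsto (fun X : ℝ => Real.log (z₀ / (m * X⁻¹)) ^ ℓ * ((z₁ - z₀) / (m * X⁻¹) - 1) /
      (X * Real.log (a * X) ^ ℓ)) atTop (𝓝 ((z₁ - z₀) / m)) := by
  have hlim := ((tendsto_log_mul_div_log_mul (div_pos hz₀ hm) ha).pow ℓ).mul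
    (tendsto_inv_atTop_zero.const_sub ((z₁ - z₀) / m))
  rw [one_pow, one_mul, sub_zero] at hlim
  refine hlim.congr' ?_
  filter_upwards [eventually_gt_atTop 0] with X hX
  rw [show z₀ / (m * X⁻¹) = z₀ / m * X by field_simp, div_pow, div_mul_eq_div_div,
    show ((z₁ - z₀) / (m * X⁻¹) - 1) = X * ((z₁ - z₀) / m - X⁻¹) by field_simp]
  field_simp

lemma eventually_le_tsum_log_pow_mul_dilateSum (hb0 : ∀ y, 0 ≤ b y) (hb : ∀ y, 1 ≤ y → b y = 0)
    (hb1 : ∀ y ∈ Icc z₀ z₁, b y = 1) (hz₀ : 0 < z₀) (ℓ N : ℕ) {c : ℕ → ℝ} (hc : ∀ m, 0 ≤ c m)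
    {a κ : ℝ} (ha : 0 < a) (hκ : κ < (z₁ - z₀) * ∑ m ∈ Finset.Icc 1 N, c m / m) :
    ∀ᶠ X : ℝ in atTop, κ * (X * Real.log (a * X) ^ ℓ) ≤
      ∑' n : ℕ, Real.log n ^ ℓ * dilateSum N c b (n * X⁻¹) := by
  have hlim : Tendsto (fun X : ℝ => ∑ m ∈ Finset.Icc 1 N,
      c m * (Real.log (z₀ / (m * X⁻¹)) ^ ℓ * ((z₁ - z₀) / (m * X⁻¹) - 1) /
        (X * Real.log (a * X) ^ ℓ))) atTop (𝓝 ((z₁ - z₀) * ∑ m ∈ Finset.Icc 1 N, c m / m)) := by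
    simp only [Finset.mul_sum, mul_div_left_comm (z₁ - z₀)]
    exact tendsto_finsetSum _ fun m hm =>
      (tendsto_log_pow_mul_div ℓ hz₀ z₁ ha (natCast_pos_of_mem_Icc hm)).const_mul (c m)
  filter_upwards [hlim.eventually (lt_mem_nhds hκ), eventually_gt_atTop 0,
    eventually_ge_atTop (N / z₀), (Real.tendsto_log_atTop.comp
      (tendsto_id.const_mul_atTop ha)).eventually_gt_atTop 0] with X hlt hX hNX hlogX
  have hscale : 0 < X * Real.log (a * X) ^ ℓ := mul_pos hX (pow_pos hlogX ℓ)
  simp only [← mul_div_assoc, ← Finset.sum_div] at hlt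
  rw [tsum_mul_dilateSum _ N c hb (inv_pos.2 hX)]
  refine ((lt_div_iff₀ hscale).1 hlt).le.trans (Finset.sum_le_sum fun m hm => ?_)
  refine mul_le_mul_of_nonneg_left (log_pow_mul_le_tsum_log_pow_mul hb0 hb hb1 ℓ
    (mul_pos (natCast_pos_of_mem_Icc hm) (inv_pos.2 hX)) ?_) (hc m)
  rw [← div_eq_mul_inv, div_le_iff₀ hX, mul_comm]
  exact (Nat.cast_le.2 (Finset.mem_Icc.1 hm).2).trans ((div_le_iff₀ hz₀).1 hNX)

end DilateSumLowerBound

section ResonatorChoice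

open MeasureTheory

variable {b : ℝ → ℝ} {w σ : ℝ}

lemma tendsto_sum_rpow_neg {p : ℝ} (hp : 1 < p) :
    Tendsto (fun N : ℕ => ∑ m ∈ Finset.Icc 1 N, (m : ℝ) ^ (-p)) atTop
      (𝓝 (riemannZeta (p : ℂ)).re) := by
  have hreal : riemannZeta (p : ℂ) = ((∑' n : ℕ, (n : ℝ) ^ (-p) : ℝ) : ℂ) := by
    rw [zeta_eq_tsum_one_div_nat_cpow (by simpa using hp), Complex.ofReal_tsum]
    refine tsum_congr fun n => ?_
    rw [one_div, ← Complex.cpow_neg, Complex.ofReal_cpow n.cast_nonneg, Complex.ofReal_neg,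
      Complex.ofReal_natCast]
  have hsum := (Real.summable_nat_rpow.2 (neg_lt_neg hp)).hasSum.tendsto_sum_nat
  rw [hreal, Complex.ofReal_re]
  refine (hsum.comp (tendsto_add_atTop_nat 1)).congr fun N => ?_
  rw [Function.comp_apply, Finset.sum_range_succ', Finset.range_eq_Ico,
    Finset.sum_Ico_add' (fun m : ℕ => (m : ℝ) ^ (-p)) 0 N 1, Nat.cast_zero,
    Real.zero_rpow (by linarith), add_zero]
  rfl

lemma exists_contDiff_cutoff {θ : ℝ} (hw : w < 1) (hθ0 : 0 < θ) (hθ1 : θ < 1) :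
    ∃ (b : ℝ → ℝ) (z₀ z₁ : ℝ), ContDiff ℝ (⊤ : ℕ∞) b ∧ tsupport b ⊆ Ioo w 1 ∧
      (∀ y, b y ∈ Icc (0 : ℝ) 1) ∧ w < z₀ ∧ z₁ - z₀ = θ * (1 - w) ∧ ∀ y ∈ Icc z₀ z₁, b y = 1 := by
  obtain ⟨r, hr⟩ : ∃ r, (1 - w) / 2 = r := ⟨_, rfl⟩
  have hr0 : 0 < r := by linarith
  obtain ⟨θ', hθθ', hθ'1⟩ := exists_between hθ1
  have hin : θ * r < θ' * r := by gcongr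
  have hout : θ' * r < r := mul_lt_of_lt_one_left hr0 hθ'1
  let f : ContDiffBump ((1 + w) / 2 : ℝ) := ⟨θ * r, θ' * r, by positivity, hin⟩
  refine ⟨f, (1 + w) / 2 - θ * r, (1 + w) / 2 + θ * r, f.contDiff, ?_,
    fun y => ⟨f.nonneg, f.le_one⟩, by linarith, by rw [← hr]; ring, fun y hy => ?_⟩
  · rw [f.tsupport_eq, Real.closedBall_eq_Icc]
    exact Icc_subset_Ioo (by linarith) (by linarith)
  · exact f.one_of_mem_closedBall (by rwa [Real.closedBall_eq_Icc])

lemma integral_rpow_mul_sq_le (hw : 0 < w) (hw1 : w < 1) (hbs : tsupport b ⊆ Ioo w 1)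
    (hb : ∀ y, b y ∈ Icc (0 : ℝ) 1) (hσ : σ ≤ 1 / 2) :
    ∫ y in Ioi (0 : ℝ), y ^ (2 * σ - 1) * b y ^ 2 ≤ w ^ (2 * σ - 1) * (1 - w) := by
  have hrestrict : ∫ y in Ioi (0 : ℝ), y ^ (2 * σ - 1) * b y ^ 2 =
      ∫ y in Ioo w 1, y ^ (2 * σ - 1) * b y ^ 2 :=
    setIntegral_eq_of_subset_of_forall_sdiff_eq_zero measurableSet_Ioi
      (fun y hy => hw.trans hy.1) fun y hy => by
        rw [image_eq_zero_of_notMem_tsupport fun h => hy.2 (hbs h), sq, mul_zero, mul_zero]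
  rw [hrestrict, ← Real.volume_real_Ioo_of_le hw1.le]
  refine (Real.le_norm_self _).trans (norm_setIntegral_le_of_norm_le_const
    measure_Ioo_lt_top fun y hy => ?_)
  have hy0 : 0 < y := hw.trans hy.1
  rw [Real.norm_of_nonneg (by positivity)]
  calc y ^ (2 * σ - 1) * b y ^ 2 ≤ y ^ (2 * σ - 1) * 1 := by
        gcongr
        exact pow_le_one₀ (hb y).1 (hb y).2
    _ ≤ w ^ (2 * σ - 1) := by
        rw [mul_one]
        exact Real.rpow_le_rpow_of_nonpos hw hy.1.le (by linarith)

lemma sum_resonator_div {σ : ℝ} (N : ℕ) :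
    ∑ m ∈ Finset.Icc 1 N, (m : ℝ) ^ (2 * σ - 1) / m =
      ∑ m ∈ Finset.Icc 1 N, (m : ℝ) ^ (-(2 - 2 * σ)) :=
  Finset.sum_congr rfl fun m hm => by
    rw [← Real.rpow_sub_one (natCast_pos_of_mem_Icc hm).ne']
    ring_nf

lemma sum_resonator_sq_mul {σ : ℝ} (N : ℕ) :
    ∑ m ∈ Finset.Icc 1 N, ((m : ℝ) ^ (2 * σ - 1)) ^ 2 * (m : ℝ) ^ (-(2 * σ)) =
      ∑ m ∈ Finset.Icc 1 N, (m : ℝ) ^ (-(2 - 2 * σ)) :=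
  Finset.sum_congr rfl fun m hm => by
    have hm0 := natCast_pos_of_mem_Icc hm
    rw [← Real.rpow_natCast, ← Real.rpow_mul hm0.le, ← Real.rpow_add hm0]
    push_cast
    ring_nf

end ResonatorChoice

section Resonance

open MeasureTheory Complex

variable {b : ℝ → ℝ} {w σ z₀ z₁ η : ℝ}

lemma eventually_const_mul_rpow_lt (C : ℝ) {δ a : ℝ} (hδ : 0 < δ) (ha : 0 < a) (ℓ : ℕ) :
    ∀ᶠ X : ℝ in atTop, C * X ^ (3 / 4 : ℝ) < δ * (X * Real.log (a * X) ^ ℓ) := by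
  filter_upwards [eventually_gt_atTop 0,
    (tendsto_rpow_atTop (by norm_num : (0 : ℝ) < 1 / 4)).eventually_gt_atTop (C / δ),
    (Real.tendsto_log_atTop.comp (tendsto_id.const_mul_atTop ha)).eventually_ge_atTop 1]
    with X hX hroot hlog
  calc C * X ^ (3 / 4 : ℝ) < δ * X ^ (1 / 4 : ℝ) * X ^ (3 / 4 : ℝ) := by
        gcongr
        exact (div_lt_iff₀' hδ).1 hroot
    _ = δ * X := by
        rw [mul_assoc, ← Real.rpow_add hX]
        norm_num
    _ ≤ δ * (X * Real.log (a * X) ^ ℓ) := by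
        gcongr
        exact le_mul_of_one_le_right hX.le (one_le_pow₀ hlog)

lemma eventually_exists_le_norm_of_lt (hw : 0 < w) (hw1 : w < 1) (hb : ContDiff ℝ (⊤ : ℕ∞) b)
    (hbs : tsupport b ⊆ Ioo w 1) (hb0 : ∀ y, 0 ≤ b y) (hz₀ : 0 < z₀)
    (hb1 : ∀ y ∈ Icc z₀ z₁, b y = 1) {N : ℕ} (hN : N ≤ w * (N + 1)) {c : ℕ → ℝ}
    (hc : ∀ m, 0 ≤ c m) (ℓ : ℕ) (hσ : σ < 1)
    (hη : η * √((1 - w) * ((∑ m ∈ Finset.Icc 1 N, c m ^ 2 * (m : ℝ) ^ (-(2 * σ))) *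
      ∫ y in Ioi (0 : ℝ), y ^ (2 * σ - 1) * b y ^ 2)) <
        (z₁ - z₀) * ∑ m ∈ Finset.Icc 1 N, c m / m) :
    ∀ᶠ X : ℝ in atTop, ∃ t ∈ Icc (w * (2 * Real.pi * X)) (2 * Real.pi * X),
      η * (X ^ (1 / 2 - σ) * Real.log (2 * Real.pi * X) ^ ℓ) ≤
        ‖iteratedDeriv ℓ riemannZeta (σ + t * I)‖ := by
  obtain ⟨κ, hηκ, hκ⟩ := exists_between hη
  obtain ⟨C, -, hupper⟩ := exists_abs_tsum_log_pow_mul_dilateSum_le hw hw1 hb hbs hN c ℓ hσ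
  have hb_zero : ∀ y, 1 ≤ y → b y = 0 := fun y hy =>
    image_eq_zero_of_notMem_tsupport fun h => (hbs h).2.not_ge hy
  filter_upwards [eventually_ge_atTop 1,
    eventually_le_tsum_log_pow_mul_dilateSum hb0 hb_zero hb1 hz₀ ℓ N hc Real.two_pi_pos hκ,
    eventually_const_mul_rpow_lt C (sub_pos.2 hηκ) Real.two_pi_pos ℓ] with X hX hlower herror
  have hX0 : 0 < X := zero_lt_one.trans_le hX
  set V := √((1 - w) * ((∑ m ∈ Finset.Icc 1 N, c m ^ 2 * (m : ℝ) ^ (-(2 * σ))) *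
      ∫ y in Ioi (0 : ℝ), y ^ (2 * σ - 1) * b y ^ 2))
  set L := Real.log (2 * Real.pi * X) ^ ℓ
  by_contra! hsmall
  have hmem : 2 * Real.pi * X ∈ Icc (w * (2 * Real.pi * X)) (2 * Real.pi * X) :=
    ⟨mul_le_of_le_one_left (by positivity) hw1.le, le_rfl⟩
  have hsum := hupper X hX _ ((norm_nonneg _).trans (hsmall _ hmem).le)
    fun t ht => (hsmall t ht).le
  have hmain : η * (X ^ (1 / 2 - σ) * L) * X ^ (σ + 1 / 2) * V = η * V * (X * L) := by
    have hpow : X ^ (1 / 2 - σ) * X ^ (σ + 1 / 2) = X := by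
      rw [← Real.rpow_add hX0, show 1 / 2 - σ + (σ + 1 / 2) = 1 by ring, Real.rpow_one]
    linear_combination η * L * V * hpow
  linarith [le_abs_self (∑' n : ℕ, Real.log n ^ ℓ * dilateSum N c b (n * X⁻¹))]

lemma exists_resonator_parameters {w₀ : ℝ} (hw₀ : w₀ < 1) (hσ : σ < 1 / 2)
    (hη : η < √(riemannZeta ((2 - 2 * σ : ℝ) : ℂ)).re) :
    ∃ (N : ℕ) (w θ : ℝ), w₀ ≤ w ∧ 0 < w ∧ w < 1 ∧ N ≤ w * (N + 1) ∧ 0 < θ ∧ θ < 1 ∧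
      η * w ^ (σ - 1 / 2) < θ * √(∑ m ∈ Finset.Icc 1 N, (m : ℝ) ^ (-(2 - 2 * σ))) := by
  obtain ⟨N, hN⟩ := ((tendsto_sum_rpow_neg (by linarith : 1 < 2 - 2 * σ)).sqrt.eventually
    (lt_mem_nhds hη)).exists
  set A := ∑ m ∈ Finset.Icc 1 N, (m : ℝ) ^ (-(2 - 2 * σ))
  have hw_lim : Tendsto (fun w : ℝ => η * w ^ (σ - 1 / 2)) (𝓝[<] 1) (𝓝 η) := by
    simpa using ((Real.continuousAt_rpow_const 1 (σ - 1 / 2) (Or.inl one_ne_zero)).const_mul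
      η).tendsto.mono_left nhdsWithin_le_nhds
  have hθ_lim : Tendsto (fun θ : ℝ => θ * √A) (𝓝[<] 1) (𝓝 √A) :=
    ((continuous_id.mul_const √A).tendsto' 1 _ (one_mul _)).mono_left nhdsWithin_le_nhds
  have hN1 : (N : ℝ) / (N + 1) < 1 := (div_lt_one (by positivity)).2 (lt_add_one _)
  obtain ⟨w, hwη, hw, hw1⟩ := ((hw_lim.eventually (gt_mem_nhds hN)).and
    (Ioo_mem_nhdsLT (max_lt (max_lt hw₀ zero_lt_one) hN1))).exists
  obtain ⟨⟨hw₀w, hw0⟩, hNw⟩ := (max_lt_iff.1 hw).imp_left max_lt_iff.1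
  obtain ⟨θ, hwθ, hθ⟩ := ((hθ_lim.eventually (lt_mem_nhds hwη)).and
    (Ioo_mem_nhdsLT zero_lt_one)).exists
  exact ⟨N, w, θ, hw₀w.le, hw0, hw1, ((div_lt_iff₀ (by positivity)).1 hNw).le, hθ.1, hθ.2, hwθ⟩

lemma mul_sqrt_lt_mul_of_mul_rpow_lt {A m θ : ℝ} (hη : 0 ≤ η) (hw : 0 < w) (hw1 : w < 1)
    (hm : m ≤ w ^ (2 * σ - 1) * (1 - w)) (hηθ : η * w ^ (σ - 1 / 2) < θ * √A) :
    η * √((1 - w) * (A * m)) < θ * (1 - w) * A := by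
  have hA : 0 < A := by
    by_contra! hA
    rw [Real.sqrt_eq_zero_of_nonpos hA, mul_zero] at hηθ
    exact hηθ.not_ge (by positivity)
  have hw1' : 0 < 1 - w := sub_pos.2 hw1
  have hsq : (w ^ (σ - 1 / 2)) ^ 2 = w ^ (2 * σ - 1) := by
    rw [← Real.rpow_mul_natCast hw.le]
    ring_nf
  calc η * √((1 - w) * (A * m)) ≤ η * √(((1 - w) * w ^ (σ - 1 / 2)) ^ 2 * A) := by
        refine mul_le_mul_of_nonneg_left (Real.sqrt_le_sqrt ?_) hη
        calc (1 - w) * (A * m) ≤ (1 - w) * (A * (w ^ (2 * σ - 1) * (1 - w))) := by gcongr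
          _ = ((1 - w) * w ^ (σ - 1 / 2)) ^ 2 * A := by rw [← hsq]; ring
    _ = (η * w ^ (σ - 1 / 2)) * ((1 - w) * √A) := by
        rw [Real.sqrt_mul (by positivity), Real.sqrt_sq (by positivity)]
        ring
    _ < (θ * √A) * ((1 - w) * √A) := by gcongr
    _ = θ * (1 - w) * A := by
        linear_combination θ * (1 - w) * Real.mul_self_sqrt hA.le

lemma eventually_exists_rpow_mul_log_pow_le_norm (ℓ : ℕ) (hσ : σ < 1 / 2) {w₀ : ℝ} (hw₀ : w₀ < 1)
    (hη0 : 0 ≤ η) (hη : η < √(riemannZeta ((2 - 2 * σ : ℝ) : ℂ)).re) :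
    ∀ᶠ X : ℝ in atTop, ∃ t ∈ Icc (w₀ * (2 * Real.pi * X)) (2 * Real.pi * X),
      η * (X ^ (1 / 2 - σ) * Real.log (2 * Real.pi * X) ^ ℓ) ≤
        ‖iteratedDeriv ℓ riemannZeta (σ + t * I)‖ := by
  obtain ⟨N, w, θ, hw₀w, hw, hw1, hN, hθ, hθ1, hηθ⟩ := exists_resonator_parameters hw₀ hσ hη
  obtain ⟨b, z₀, z₁, hb, hbs, hb01, hwz, hlength, hb1⟩ := exists_contDiff_cutoff hw1 hθ hθ1
  have hgain := mul_sqrt_lt_mul_of_mul_rpow_lt hη0 hw hw1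
    (integral_rpow_mul_sq_le hw hw1 hbs hb01 hσ.le) hηθ
  filter_upwards [eventually_ge_atTop 0, eventually_exists_le_norm_of_lt hw hw1 hb hbs
    (fun y => (hb01 y).1) (hw.trans hwz) hb1 hN (c := fun m => (m : ℝ) ^ (2 * σ - 1))
    (fun m => by positivity) ℓ (σ := σ) (η := η) (by linarith)
    (by rwa [sum_resonator_sq_mul, sum_resonator_div, hlength])] with X hX ⟨t, ht, hle⟩
  exact ⟨t, ⟨le_trans (by gcongr) ht.1, ht.2⟩, hle⟩

end Resonance

lemma eventually_rpow_le_mul {β : ℝ} (hβ : β < 1) {a : ℝ} (ha : 0 < a) :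
    ∀ᶠ T : ℝ in atTop, T ^ β ≤ a * T := by
  filter_upwards [(tendsto_rpow_neg_atTop (sub_pos.2 hβ)).eventually (gt_mem_nhds ha),
    eventually_gt_atTop 0] with T hT hT0
  calc T ^ β = T ^ (-(1 - β)) * T := by rw [← Real.rpow_add_one hT0.ne', neg_sub, sub_add_cancel]
    _ ≤ a * T := by gcongr

theorem mainTheorem5_general (ℓ : ℕ) {σ : ℝ} (hσ : σ < 1 / 2) {w : ℝ} (hw : w < 1) {η : ℝ}
    (hη : η < Real.sqrt (riemannZeta ((2 - 2 * σ : ℝ) : ℂ)).re) :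
    ∀ᶠ T : ℝ in atTop, ∃ t ∈ Icc (w * T) T,
      (2 * Real.pi) ^ (σ - 1 / 2) * η * T ^ (1 / 2 - σ) * Real.log T ^ ℓ ≤
        ‖iteratedDeriv ℓ riemannZeta ((σ : ℂ) + (t : ℂ) * Complex.I)‖ := by
  have hζ : 0 < (riemannZeta ((2 - 2 * σ : ℝ) : ℂ)).re :=
    riemannZeta_re_pos_of_one_lt (by linarith)
  have hscale : Tendsto (fun T : ℝ => T / (2 * Real.pi)) atTop atTop :=
    tendsto_id.atTop_div_const Real.two_pi_pos
  filter_upwards [eventually_ge_atTop 1, hscale.eventually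
    (eventually_exists_rpow_mul_log_pow_le_norm ℓ hσ hw (le_max_right η 0)
      (max_lt hη (Real.sqrt_pos.2 hζ)))] with T hT ⟨t, ht, hle⟩
  have hT0 : 0 < T := zero_lt_one.trans_le hT
  rw [mul_div_cancel₀ T Real.two_pi_pos.ne'] at ht hle
  refine ⟨t, ht, le_trans ?_ hle⟩
  have hpow : (T / (2 * Real.pi)) ^ (1 / 2 - σ) =
      (2 * Real.pi) ^ (σ - 1 / 2) * T ^ (1 / 2 - σ) := by
    rw [Real.div_rpow hT0.le Real.two_pi_pos.le, ← neg_sub σ, Real.rpow_neg Real.two_pi_pos.le,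
      div_inv_eq_mul, mul_comm]
  calc (2 * Real.pi) ^ (σ - 1 / 2) * η * T ^ (1 / 2 - σ) * Real.log T ^ ℓ
      = η * ((T / (2 * Real.pi)) ^ (1 / 2 - σ) * Real.log T ^ ℓ) := by rw [hpow]; ring
    _ ≤ max η 0 * ((T / (2 * Real.pi)) ^ (1 / 2 - σ) * Real.log T ^ ℓ) := by
        have hlog : 0 ≤ Real.log T := Real.log_nonneg hT
        gcongr
        exact le_max_left η 0

theorem mainTheorem5 (ℓ : ℕ) (β : ℝ) (hβ₀ : 0 ≤ β) (hβ₁ : β < 1) (σ : ℝ) (hσ : σ < 1 / 2) :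
    ∃ M ε : ℝ → ℝ,
      (∀ T : ℝ, 1 ≤ T →
        IsGreatest ((fun t : ℝ => ‖iteratedDeriv ℓ riemannZeta ((σ : ℂ) + (t : ℂ) * Complex.I)‖) ''
          Icc (T ^ β) T) (M T)) ∧
      Tendsto ε atTop (𝓝 0) ∧
      ∀ᶠ T : ℝ in atTop,
        (1 + ε T) * (2 * Real.pi) ^ (σ - 1 / 2) *
            Real.sqrt ((riemannZeta ((2 - 2 * σ : ℝ) : ℂ)).re / (2 - 2 * σ)) *
            T ^ (1 / 2 - σ) * Real.log T ^ ℓ ≤ M T := by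
  set f : ℝ → ℝ := fun t => ‖iteratedDeriv ℓ riemannZeta ((σ : ℂ) + (t : ℂ) * Complex.I)‖
  have hf : Continuous f :=
    (continuous_iteratedDeriv_riemannZeta_vertical ℓ (by linarith : σ < 1).ne).norm
  have hmax : ∀ T : ℝ, 1 ≤ T → IsGreatest (f '' Icc (T ^ β) T) (sSup (f '' Icc (T ^ β) T)) :=
    fun T hT => (isCompact_Icc.image hf).isGreatest_sSup
      ((nonempty_Icc.2 (Real.rpow_le_self_of_one_le hT hβ₁.le)).image f)
  have hζ : 0 < (riemannZeta ((2 - 2 * σ : ℝ) : ℂ)).re :=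
    riemannZeta_re_pos_of_one_lt (by linarith)
  have hη := Real.sqrt_lt_sqrt (div_nonneg hζ.le (by linarith))
    (div_lt_self hζ (by linarith : 1 < 2 - 2 * σ))
  refine ⟨_, fun _ => 0, hmax, tendsto_const_nhds, ?_⟩
  filter_upwards [eventually_ge_atTop 1, eventually_rpow_le_mul hβ₁ one_half_pos,
    mainTheorem5_general ℓ hσ one_half_lt_one hη] with T hT hβT ⟨t, ht, hle⟩
  rw [add_zero, one_mul]
  exact hle.trans ((hmax T hT).2 ⟨t, ⟨hβT.trans ht.1, ht.2⟩, rfl⟩)
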